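/- **Setting.** Let $D\ge 1$, let $\mathcal A$ be a finite alphabet, $\mathfrak A\subseteq\mathcal A^{\mathbb Z^D}$ a subshift, and write $\mathbb B(z,r)=z+[-r..r]^D$. A block on $\mathbb B(z,r)$ is *admissible* if, translated to the origin, it is the restriction to $[-r..r]^D$ of some $b\in\mathfrak A$. For $\mathbf a\in\mathcal A^{\mathbb Z^D}$ let $\mathcal F(z)\in\mathbb N\cup\{\infty\}$ be the supremum of the $r$ for which $\mathbf a_{\mathbb B(z,r)}$ is admissible, and let $\mathbb G_R(\mathbf a)=\{z:\mathcal F(z)\ge R\}$. Assume $\sup_z\mathcal F(z)=\infty$. The defect of $\mathbf a$ is *removable* if for some $r>0$ there is $\mathbf a'\in\mathfrak A$ that agrees with $\mathbf a$ on $\mathbb G_r(\mathbf a)$; otherwise it is *essential*. A *trail* is a nearest-neighbour path in $\mathbb Z^D$. For $Y\subseteq\mathbb Z^D$ let $\mathbf Y\subseteq\mathbb R^D$ be the union of the unit cubes $z+[0,1]^D$ all of whose corners lie in $Y$. A trail-connected component $Y$ of $\mathbb G_{r_0}(\mathbf a)$ is *projective* if it meets $\mathbb G_R(\mathbf a)$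 for every $R\ge r_0$. Assume that, for some $r_0$, $\mathbb G_{r_0}(\mathbf a)$ has exactly one projective component $Y$; for $r>r_0$ put $Y_r=Y\cap\mathbb G_r(\mathbf a)$. A *proper base ray* is a continuous $\omega:[0,\infty)\to\mathbf Y$ with $|\omega(t)|\to\infty$ such that, for every $r$, $\omega(t)\in\mathbf Y_r$ for all large $t$. Put $\pi_1(\mathbb G_\infty(\mathbf a),\omega)=\varprojlim_{r>r_0}\pi_1(\mathbf Y_r,\omega(t_r))$, where $\omega([t_r,\infty))\subseteq\mathbf Y_r$ and base points are changed along $\omega$. Assume that $\mathbf a$ has a *projective codimension-two defect*: $\pi_1(\mathbb G_\infty(\mathbf a),\omega')$ is nontrivial for some proper base ray $\omega'$. Let $G$ be a discrete group. A *cocycle* is a continuous $C:\mathbb Z^D\times\mathfrak A\to G$ with $C(y+z,\mathbf b)=C(y,\sigma^z\mathbf b)\,C(z,\mathbf b)$, where $(\sigma^z\mathbf b)_y=b_{y+z}$. Cocycles $C,C'$ are *cohomologous* if $C'(z,\mathbf b)=\beta(\sigma^z\mathbf b)C(z,\mathbf b)\beta(\mathbf b)^{-1}$ for some continuous $\beta:\mathfrak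 A\to G$; $H^1_{dy}(\mathfrak A,G)$ is the set of cohomology classes. A *local rule* of radius $s$ for $C$ is a function $c$ with $C(e,\mathbf b)=c(e,\mathbf b_{\mathbb B(0,s)})$ for all unit steps $e$ and all $\mathbf b\in\mathfrak A$. For a trail $\zeta=(z_0,\dots,z_N)$ in $Y_R$ with $R>s$ put $C(\zeta,\mathbf a)=c(z_N-z_{N-1},\mathbf a_{\mathbb B(z_{N-1},s)})\cdots c(z_1-z_0,\mathbf a_{\mathbb B(z_0,s)})$. A *basing* consists of a range $R>r_0$, a time $t$ with $\omega([t,\infty))\subseteq\mathbf Y_R$, a lattice point $y\in\mathbf Y_R$ and a path $\gamma$ in $\mathbf Y_R$ from $\omega(t)$ to $y$. A closed trail $\zeta$ in $Y_R$ at $y$ *represents* $x\in\pi_1(\mathbb G_\infty(\mathbf a),\omega)$ if its piecewise linear loop lies in $\mathbf Y_R$ and $\gamma\star\zeta\star\bar\gamma$ is in the class of the component of $x$ in $\pi_1(\mathbf Y_R,\omega(t))$. **Theorem.** Let $\omega$ be a proper base ray. *(Well-definedness.)* Every cocycle has a local rule of some radius. For every $R>r_0$ there is a basing of range $R$, and for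 every basing each $x\in\pi_1(\mathbb G_\infty(\mathbf a),\omega)$ is represented by a closed trail. For each $\kappa\in H^1_{dy}(\mathfrak A,G)$ there is a function $\mathrm{res}(\kappa,\cdot):\pi_1(\mathbb G_\infty(\mathbf a),\omega)\to G$, unique up to conjugation by a fixed element of $G$, such that for every $C\in\kappa$, every local rule of $C$ (of radius $s$, say) and every basing of range $R>s$ there is $g\in G$ with $C(\zeta,\mathbf a)=g\,\mathrm{res}(\kappa,x)\,g^{-1}$ for all $x$ and all closed trails $\zeta$ representing $x$. In particular, if $G$ is abelian, $\mathrm{res}(\kappa,x)=C(\zeta,\mathbf a)$ is a well-defined element of $G$. (a) If $\mathrm{res}(\kappa,x)\ne e$ for some $\kappa,x$, then the defect of $\mathbf a$ is essential, and it is a codimension-two defect: $\pi_1(\mathbb G_\infty(\mathbf a),\omega)$ is nontrivial. (b) If $G$ is abelian, then $\mathrm{res}$ is a group homomorphism in each of its two variables. More precisely, let $\mathcal Z$ be the group of cocycles under pointwise multiplication and $\mathcal B$ the subgroup of cocycles cohomologous to a homomorphism $\mathbb Z^D\to G$. There is a unique homomorphism $\mathcal Z/\mathcal B\to\mathrm{Hom}(\pi_1(\mathbb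 G_\infty(\mathbf a),\omega),G)$ whose value at the class of each cocycle $C$ is the residue function of the cohomology class of $C$. -/

import Mathlib

open SymbolicDynamics.FullShift
open scoped NNReal unitInterval

namespace CrystalDefect

/-! ## Configurations, admissible blocks, the defect field -/

/-- The lattice `ℤ^D`. -/
abbrev Lat (D : ℕ) : Type := Fin D → ℤ

/-- The box `[-r..r]^D` in `ℤ^D`. -/
def box (D r : ℕ) : Set (Lat D) := {u | ∀ i, |u i| ≤ (r : ℤ)}

/-- The block of radius `r` of the configuration `a` around the site `z`, translated to the
origin. -/
def block {D : ℕ} {A : Type*} (r : ℕ) (a : Lat D → A) (z : Lat D) : box D r → A :=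
  fun u => a (z + u)

/-- The admissible `r`-blocks of a subshift. -/
def admissible {D : ℕ} {A : Type*} [TopologicalSpace A] (𝔄 : Subshift A (Lat D)) (r : ℕ) :
    Set (box D r → A) :=
  {w | ∃ b ∈ 𝔄.carrier, block r b 0 = w}

/-- The defect field: the largest `r` for which the `r`-block of `a` around `z` is admissible. -/
noncomputable def energy {D : ℕ} {A : Type*} [TopologicalSpace A] (𝔄 : Subshift A (Lat D))
    (a : Lat D → A) (z : Lat D) : ℕ∞ :=
  ⨆ (r : ℕ) (_ : block r a z ∈ admissible 𝔄 r), (r : ℕ∞)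

/-- The slightly defective configurations: those with unbounded defect field. -/
def slightlyDefective {D : ℕ} {A : Type*} [TopologicalSpace A] (𝔄 : Subshift A (Lat D)) :
    Set (Lat D → A) :=
  {a | ⨆ z, energy 𝔄 a z = ⊤}

/-- The unflawed region of range `R` of the configuration `a`. -/
def unflawed {D : ℕ} {A : Type*} [TopologicalSpace A] (𝔄 : Subshift A (Lat D))
    (a : Lat D → A) (R : ℕ) : Set (Lat D) :=
  {z | (R : ℕ∞) ≤ energy 𝔄 a z}

/-- The defect of `a` is removable if it can be erased by changing `a` off some unflawed region. -/
def IsRemovable {D : ℕ} {A : Type*} [TopologicalSpace A] (𝔄 : Subshift A (Lat D))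
    (a : Lat D → A) : Prop :=
  ∃ r : ℕ, 0 < r ∧ ∃ a' ∈ 𝔄.carrier, ∀ z ∈ unflawed 𝔄 a r, a' z = a z

/-- A defect is essential if it is not removable. -/
def IsEssential {D : ℕ} {A : Type*} [TopologicalSpace A] (𝔄 : Subshift A (Lat D))
    (a : Lat D → A) : Prop :=
  ¬ IsRemovable 𝔄 a

/-! ## Trails, components, cubical realization -/

/-- The unit steps `(0, …, 0, ±1, 0, …, 0)`. -/
def unitSteps (D : ℕ) : Set (Lat D) := {e | ∃ i, e = Pi.single i 1 ∨ e = Pi.single i (-1)}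

/-- The nearest-neighbour graph on `ℤ^D`. Its walks are the trails. -/
def latGraph (D : ℕ) : SimpleGraph (Lat D) where
  Adj y z := z - y ∈ unitSteps D
  symm := ⟨by
    rintro y z ⟨i, h | h⟩
    · refine ⟨i, Or.inr ?_⟩
      rw [← neg_sub, h, Pi.single_neg]
    · refine ⟨i, Or.inl ?_⟩
      rw [← neg_sub, h, Pi.single_neg, neg_neg]⟩
  loopless := ⟨by
    rintro y ⟨i, h | h⟩
    · simpa using congrFun h i
    · simpa using congrFun h i⟩

/-- A trail. -/
abbrev Trail {D : ℕ} (y z : Lat D) : Type := (latGraph D).Walk y z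

/-- All vertices of the trail lie in `S`. -/
def Trail.InSet {D : ℕ} {y z : Lat D} (ζ : Trail y z) (S : Set (Lat D)) : Prop :=
  ∀ v ∈ SimpleGraph.Walk.support ζ, v ∈ S

/-- `Y` is a (trail-)connected component of `S`. -/
def IsComponent {D : ℕ} (S Y : Set (Lat D)) : Prop :=
  ∃ y ∈ S, Y = {z | ∃ ζ : Trail y z, ζ.InSet S}

/-- `Y` is a projective connected component of the unflawed region of range `r`. -/
def IsProjectiveComponent {D : ℕ} {A : Type*} [TopologicalSpace A] (𝔄 : Subshift A (Lat D))
    (a : Lat D → A) (r : ℕ) (Y : Set (Lat D)) : Prop :=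
  IsComponent (unflawed 𝔄 a r) Y ∧ ∀ R, r ≤ R → (Y ∩ unflawed 𝔄 a R).Nonempty

/-- A lattice point seen in `ℝ^D`. -/
def toReal {D : ℕ} (z : Lat D) : Fin D → ℝ := fun i => (z i : ℝ)

/-- The corners of the unit cube at `z`. -/
def corners {D : ℕ} (z : Lat D) : Set (Lat D) := {w | ∀ i, w i = z i ∨ w i = z i + 1}

/-- The unit cube `z + [0,1]^D`. -/
def cube {D : ℕ} (z : Lat D) : Set (Fin D → ℝ) := {p | ∀ i, (z i : ℝ) ≤ p i ∧ p i ≤ z i + 1}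

/-- The union of all unit cubes with all their corners in `Y`. -/
def realization {D : ℕ} (Y : Set (Lat D)) : Set (Fin D → ℝ) :=
  {p | ∃ z, corners z ⊆ Y ∧ p ∈ cube z}

theorem realization_mono {D : ℕ} {Y Y' : Set (Lat D)} (h : Y ⊆ Y') :
    realization Y ⊆ realization Y' :=
  fun _ ⟨z, hz, hp⟩ => ⟨z, hz.trans h, hp⟩

theorem unflawed_anti {D : ℕ} {A : Type*} [TopologicalSpace A] (𝔄 : Subshift A (Lat D))
    (a : Lat D → A) {r R : ℕ} (h : r ≤ R) : unflawed 𝔄 a R ⊆ unflawed 𝔄 a r :=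
  fun _ hz => le_trans (Nat.cast_le.mpr h : (r : ℕ∞) ≤ R) hz

/-- The piecewise linear path in `ℝ^D` traced out by a trail. -/
noncomputable def Trail.path {D : ℕ} {y z : Lat D} : Trail y z → Path (toReal y) (toReal z)
  | .nil => Path.refl _
  | .cons (v := v) _ p => (Path.segment (toReal y) (toReal v)).trans (Trail.path p)

/-! ## Proper base rays and the proper fundamental group -/

/-- The realization of `Y_r`, the part of `Y` lying in the unflawed region of range `r`. -/
def region {D : ℕ} {A : Type*} [TopologicalSpace A] (𝔄 : Subshift A (Lat D))
    (a : Lat D → A) (Y : Set (Lat D)) (r : ℕ) : Set (Fin D → ℝ) :=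
  realization (Y ∩ unflawed 𝔄 a r)

theorem region_anti {D : ℕ} {A : Type*} [TopologicalSpace A] (𝔄 : Subshift A (Lat D))
    (a : Lat D → A) (Y : Set (Lat D)) {r R : ℕ} (h : r ≤ R) :
    region 𝔄 a Y R ⊆ region 𝔄 a Y r :=
  realization_mono (Set.inter_subset_inter_right _ (unflawed_anti 𝔄 a h))

/-- A proper base ray: a ray in the realization of `Y` that tends to infinity and is eventually
in the realization of `Y_r`, for each `r`. The last clause provides a base point of `Y_r` on the
ray, for each `r`, and makes the identifications along the ray possible. -/
structure ProperBaseRay {D : ℕ} {A : Type*} [TopologicalSpace A] (𝔄 : Subshift A (Lat D))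
    (a : Lat D → A) (Y : Set (Lat D)) where
  toFun : ℝ≥0 → (Fin D → ℝ)
  continuous_toFun : Continuous toFun
  mem : ∀ t, toFun t ∈ realization Y
  tendsto : Filter.Tendsto (fun t => ‖toFun t‖) Filter.atTop Filter.atTop
  eventually_mem : ∀ r : ℕ, ∀ᶠ t in Filter.atTop, toFun t ∈ region 𝔄 a Y r

namespace ProperBaseRay

variable {D : ℕ} {A : Type*} [TopologicalSpace A] {𝔄 : Subshift A (Lat D)} {a : Lat D → A}
  {Y : Set (Lat D)}

/-- A range `r > r₀` together with a time `t` after which the ray stays in the realization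
of `Y_r`. -/
structure Index (ω : ProperBaseRay 𝔄 a Y) (r₀ : ℕ) where
  r : ℕ
  t : ℝ≥0
  lt : r₀ < r
  mem : ∀ u, t ≤ u → ω.toFun u ∈ region 𝔄 a Y r

variable {ω : ProperBaseRay 𝔄 a Y} {r₀ : ℕ}

/-- The point of the ray at time `u ≥ i.t`. -/
def Index.pt (i : ω.Index r₀) (u : ℝ≥0) (h : i.t ≤ u) : region 𝔄 a Y i.r :=
  ⟨ω.toFun u, i.mem u h⟩

/-- The base point on the ray. -/
def Index.base (i : ω.Index r₀) : region 𝔄 a Y i.r := i.pt i.t le_rfl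

/-- The fundamental group of the realization of `Y_r` with base point on the ray. -/
abbrev Index.group (i : ω.Index r₀) : Type :=
  FundamentalGroup (region 𝔄 a Y i.r) i.base

/-- The segment of the ray from time `i.t` to time `u`. -/
noncomputable def Index.seg (i : ω.Index r₀) (u : ℝ≥0) (h : i.t ≤ u) :
    Path i.base (i.pt u h) where
  toFun s := i.pt (i.t + unitInterval.toNNReal s * (u - i.t)) le_self_add
  continuous_toFun := by
    refine Continuous.subtype_mk (ω.continuous_toFun.comp ?_) _
    exact continuous_const.add (unitInterval.toNNReal_continuous.mul continuous_const)
  source' := by simp [Index.base]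
  target' := by simp [Index.pt, add_tsub_cancel_of_le h]

/-- For `i ≤ j`, the homomorphism induced by inclusion, followed by change of base point back
along the ray. -/
noncomputable def Index.bond (i j : ω.Index r₀) (hr : i.r ≤ j.r) (ht : i.t ≤ j.t) :
    j.group →* i.group :=
  (FundamentalGroup.fundamentalGroupMulEquivOfPath (i.seg j.t ht).symm).toMonoidHom.comp
    (FundamentalGroup.map
      ⟨Set.inclusion (region_anti 𝔄 a Y hr), continuous_inclusion (region_anti 𝔄 a Y hr)⟩ j.base)

variable (ω r₀) in
/-- The proper fundamental group: the inverse limit, over `r > r₀`, of the fundamental groups of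
the realizations of `Y_r` with base points on the ray. The limit runs over the directed set of
all pairs of a range and a sufficiently late time, so that no base points have to be selected. -/
noncomputable def properPi1 : Subgroup (∀ i : ω.Index r₀, i.group) where
  carrier := {x | ∀ (i j : ω.Index r₀) (hr : i.r ≤ j.r) (ht : i.t ≤ j.t),
    i.bond j hr ht (x j) = x i}
  one_mem' := fun i j hr ht => map_one (i.bond j hr ht)
  mul_mem' := fun {x y} hx hy i j hr ht => by
    rw [Pi.mul_apply, Pi.mul_apply, map_mul, hx i j hr ht, hy i j hr ht]
  inv_mem' := fun {x} hx i j hr ht => by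
    rw [Pi.inv_apply, Pi.inv_apply, map_inv, hx i j hr ht]

variable (ω r₀) in
/-- A range `r`, a base point on the ray, and a path `γ` in the realization of `Y_r` from it
to a lattice point `y`. -/
structure Basing where
  idx : ω.Index r₀
  y : Lat D
  mem : toReal y ∈ region 𝔄 a Y idx.r
  γ : Path idx.base ⟨toReal y, mem⟩

/-- The closed trail `ζ` in `Y_r` represents the element `x` of the proper fundamental group: its
piecewise linear path is a loop `p` in the realization of `Y_r`, and the class of `γ ⋆ p ⋆ γ⁻¹`
is the component of `x` at range `r`. -/
def Represents (β : ω.Basing r₀) (ζ : Trail β.y β.y) (x : ω.properPi1 r₀) : Prop :=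
  ζ.InSet (Y ∩ unflawed 𝔄 a β.idx.r) ∧
  ∃ p : Path (X := region 𝔄 a Y β.idx.r) ⟨toReal β.y, β.mem⟩ ⟨toReal β.y, β.mem⟩,
    (∀ s, (p s : Fin D → ℝ) = ζ.path s) ∧
    FundamentalGroup.fromPath
      (Path.Homotopic.Quotient.mk ((β.γ.trans p).trans β.γ.symm)) = x.1 β.idx

end ProperBaseRay

/-- Projective codimension-two defect: the proper fundamental group is nontrivial (for some
proper base ray). -/
def HasProjectiveCodimTwo {D : ℕ} {A : Type*} [TopologicalSpace A] (𝔄 : Subshift A (Lat D))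
    (a : Lat D → A) (r₀ : ℕ) (Y : Set (Lat D)) : Prop :=
  ∃ ω : ProperBaseRay 𝔄 a Y, Nontrivial (ω.properPi1 r₀)

/-! ## Dynamical cocycles -/

/-- The shift as a self-map of a subshift. -/
def shiftOn {D : ℕ} {A : Type*} [TopologicalSpace A] (𝔄 : Subshift A (Lat D)) (z : Lat D)
    (b : 𝔄.carrier) : 𝔄.carrier :=
  ⟨shift z b, 𝔄.mapsTo z b.2⟩

section Cocycles

variable {D : ℕ} {A : Type*} [TopologicalSpace A] (𝔄 : Subshift A (Lat D)) (G : Type*)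

/-- Continuous dynamical cocycles. -/
def cocycles [Group G] [TopologicalSpace G] : Set (Lat D → 𝔄.carrier → G) :=
  {C | Continuous (fun p : Lat D × 𝔄.carrier => C p.1 p.2) ∧
    ∀ y z b, C (y + z) b = C y (shiftOn 𝔄 z b) * C z b}

variable {G} in
/-- Two cocycles are cohomologous if they are related by a continuous transfer function. -/
def Cohomologous [Group G] [TopologicalSpace G] (C C' : Lat D → 𝔄.carrier → G) : Prop :=
  ∃ b : 𝔄.carrier → G, Continuous b ∧
    ∀ z x, C' z x = b (shiftOn 𝔄 z x) * C z x * (b x)⁻¹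

/-- Cohomology as an equivalence relation on cocycles, `G` being discrete. -/
def cohomSetoid [Group G] [TopologicalSpace G] [DiscreteTopology G] :
    Setoid (cocycles 𝔄 G) where
  r C C' := Cohomologous 𝔄 C.1 C'.1
  iseqv :=
    { refl := fun C => ⟨fun _ => 1, continuous_const, by simp⟩
      symm := by
        rintro C C' ⟨b, hb, h⟩
        exact ⟨fun x => (b x)⁻¹, hb.inv, fun z x => by rw [h]; group⟩
      trans := by
        rintro C C' C'' ⟨b, hb, h⟩ ⟨b', hb', h'⟩
        exact ⟨fun x => b' x * b x, hb'.mul hb, fun z x => by rw [h', h]; group⟩ }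

/-- The set of cohomology classes of continuous cocycles. -/
def H1 [Group G] [TopologicalSpace G] [DiscreteTopology G] : Type _ :=
  Quotient (cohomSetoid 𝔄 G)

/-- For abelian `G`, the cocycles form a group under pointwise multiplication. -/
def cocycleGroup [CommGroup G] [TopologicalSpace G] [DiscreteTopology G] :
    Subgroup (Lat D → 𝔄.carrier → G) where
  carrier := cocycles 𝔄 G
  one_mem' := ⟨continuous_const, by simp⟩
  mul_mem' := by
    rintro C C' ⟨h₁, h₂⟩ ⟨h₁', h₂'⟩
    refine ⟨h₁.mul h₁', fun y z b => ?_⟩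
    simp only [Pi.mul_apply, h₂, h₂', mul_mul_mul_comm]
  inv_mem' := by
    rintro C ⟨h₁, h₂⟩
    refine ⟨h₁.inv, fun y z b => ?_⟩
    simp only [Pi.inv_apply, h₂, mul_inv]

/-- For abelian `G`, the subgroup of trivial cocycles: those cohomologous to a homomorphism
`ℤ^D → G`. -/
def trivialCocycles [CommGroup G] [TopologicalSpace G] [DiscreteTopology G] :
    Subgroup (cocycleGroup 𝔄 G) where
  carrier := {C | ∃ h : Multiplicative (Lat D) →* G,
    Cohomologous 𝔄 (fun z _ => h (Multiplicative.ofAdd z)) C.1}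
  one_mem' := ⟨1, fun _ => 1, continuous_const, by simp⟩
  mul_mem' := by
    rintro C C' ⟨h, b, hb, e⟩ ⟨h', b', hb', e'⟩
    refine ⟨h * h', fun x => b x * b' x, hb.mul hb', fun z x => ?_⟩
    have : (C * C').1 z x = C.1 z x * C'.1 z x := rfl
    rw [this, e, e']
    simp only [MonoidHom.mul_apply, mul_inv]
    ac_rfl
  inv_mem' := by
    rintro C ⟨h, b, hb, e⟩
    refine ⟨h⁻¹, fun x => (b x)⁻¹, hb.inv, fun z x => ?_⟩
    have : (C⁻¹).1 z x = (C.1 z x)⁻¹ := rfl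
    rw [this, e]
    simp only [MonoidHom.inv_apply, mul_inv]

/-- For abelian `G`, the first dynamical cohomology group. -/
abbrev H1Group [CommGroup G] [TopologicalSpace G] [DiscreteTopology G] : Type _ :=
  cocycleGroup 𝔄 G ⧸ trivialCocycles 𝔄 G

variable {G}

/-- `c` is a local rule of radius `s` for the cocycle `C`. Only the values of `c` at unit steps
and admissible blocks matter. -/
def IsLocalRule (C : Lat D → 𝔄.carrier → G) (s : ℕ) (c : Lat D → (box D s → A) → G) : Prop :=
  ∀ e ∈ unitSteps D, ∀ b : 𝔄.carrier, c e (block s b.1 0) = C e b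

end Cocycles

/-- The value `c(ζ, a)` of a local rule along a trail: the product of
`c(z_n - z_{n-1}, a_{B(z_{n-1}, s)})`, with later steps on the left, as in the cocycle equation. -/
def Trail.value {D s : ℕ} {A G : Type*} [Group G] (c : Lat D → (box D s → A) → G)
    (a : Lat D → A) {y z : Lat D} : Trail y z → G
  | .nil => 1
  | .cons (v := v) _ p => Trail.value c a p * c (v - y) (block s a y)

/-- `ρ` is the residue function `x ↦ C(ζ, a)` of the cohomology class `κ`: whatever the
representing cocycle, its radius `s` and local rule, the range `r > s` and the base points, the
values along all trails `ζ` in `Y_r` representing `x` are given by `ρ x`, up to a conjugation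
that does not depend on `x` or `ζ`. -/
def IsResidue {D : ℕ} {A : Type*} [TopologicalSpace A] {𝔄 : Subshift A (Lat D)}
    {a : Lat D → A} {Y : Set (Lat D)} {r₀ : ℕ} (ω : ProperBaseRay 𝔄 a Y)
    {G : Type*} [Group G] [TopologicalSpace G] [DiscreteTopology G]
    (κ : H1 𝔄 G) (ρ : ω.properPi1 r₀ → G) : Prop :=
  ∀ C : cocycles 𝔄 G, (Quotient.mk (cohomSetoid 𝔄 G) C : H1 𝔄 G) = κ →
  ∀ (s : ℕ) (c : Lat D → (box D s → A) → G), IsLocalRule 𝔄 C.1 s c →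
  ∀ β : ω.Basing r₀, s < β.idx.r →
    ∃ g : G, ∀ (x : ω.properPi1 r₀) (ζ : Trail β.y β.y),
      ProperBaseRay.Represents β ζ x → ζ.value c a = g * ρ x * g⁻¹

end CrystalDefect

namespace CrystalDefect

/-! ## Boxes, blocks and admissibility -/

section Lattice

variable {D : ℕ} {A G : Type*}

/-! A cocycle defines a flat bundle with fibre `G` over the realization of an unflawed region, and
the residue is its holonomy. Near a site `u` of range `R` the configuration `a` coincides with some
`b ∈ 𝔄` on a box of radius `R`. On `b`, the value of a local rule along a trail depends only on the
end points, by the cocycle equation (`value_eq_cocycle`). If `s < R`, this box contains all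
`s`-blocks around the corners of any cube at `u`, so values of the rule along trails within one cube
of the region depend only on the end points. They are therefore transition functions for the cover
by open stars of lattice points: stars with a common point are centred at corners of a common cube
of the region.

Since `G` is discrete, the glued bundle is a covering. Its monodromy is homotopy invariant and
multiplicative, and on trails it gives the value of the rule (`exists_holonomy`). Conversely,
cellular approximation (`isCellular`) turns each homotopy class between lattice points into a trail,
which provides representatives.

Changing the basing conjugates values by holonomies of fixed paths (`exists_value_eq_conj`);
changing the cocycle in its class conjugates them by a locally readable transfer function
(`exists_value_eq_of_cohomologous`). Hence the residue exists up to conjugation. If the defect is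
removable, a closed trail of large range sees the same blocks in some `a' ∈ 𝔄`, where its value is
trivial. For abelian `G` conjugation disappears, and multiplicativity of holonomy and of local rules
gives the two homomorphisms. -/

theorem box_mono {r s : ℕ} (h : r ≤ s) : box D r ⊆ box D s :=
  fun _ hu i => (hu i).trans (Nat.cast_le.mpr h)

theorem add_mem_box {r s : ℕ} {u v : Lat D} (hu : u ∈ box D r) (hv : v ∈ box D s) :
    u + v ∈ box D (r + s) := fun i => by
  push_cast
  exact (abs_add_le _ _).trans (add_le_add (hu i) (hv i))

theorem finite_box (D r : ℕ) : (box D r).Finite := by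
  refine (Set.finite_Icc (fun _ : Fin D => -(r : ℤ)) (fun _ => (r : ℤ))).subset fun u hu => ?_
  exact ⟨fun i => (abs_le.mp (hu i)).1, fun i => (abs_le.mp (hu i)).2⟩

theorem block_eq_iff {r : ℕ} {a b : Lat D → A} {y z : Lat D} :
    block r a y = block r b z ↔ ∀ u ∈ box D r, a (y + u) = b (z + u) :=
  ⟨fun h u hu => congrFun h ⟨u, hu⟩, fun h => funext fun u => h u u.2⟩

theorem block_eq_of_le {r s : ℕ} (h : r ≤ s) {a b : Lat D → A} {y z : Lat D}
    (hab : block s a y = block s b z) : block r a y = block r b z :=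
  block_eq_iff.mpr fun u hu => block_eq_iff.mp hab u (box_mono h hu)

theorem block_shift (r : ℕ) (a : Lat D → A) (v z : Lat D) :
    block r (shift v a) z = block r a (v + z) :=
  funext fun u => congrArg a (add_assoc v z u).symm

/-- Agreement on a box passes to smaller boxes inside it. -/
theorem block_eq_of_sub_mem {r s t : ℕ} {a b : Lat D → A} {y z : Lat D}
    (hab : block t a y = block t b y) (hz : z - y ∈ box D s) (h : s + r ≤ t) :
    block r a z = block r b z := by
  refine block_eq_iff.mpr fun u hu => ?_
  have := block_eq_iff.mp hab ((z - y) + u) (box_mono h (add_mem_box hz hu))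
  simpa [← add_assoc] using this

theorem unitSteps_subset_box : unitSteps D ⊆ box D 1 := by
  rintro e ⟨i, rfl | rfl⟩ j <;> rcases eq_or_ne j i with rfl | h <;> simp [*]

theorem finite_unitSteps (D : ℕ) : (unitSteps D).Finite :=
  (finite_box D 1).subset unitSteps_subset_box

variable [TopologicalSpace A]

/-- If all admissible radii were below `R`, their supremum would be at most `R - 1`. Positivity of
`R` excludes the empty supremum, which is `0`. -/
theorem exists_le_of_mem_unflawed {𝔄 : Subshift A (Lat D)} {a : Lat D → A} {R : ℕ} (hR : 0 < R)
    {z : Lat D} (hz : z ∈ unflawed 𝔄 a R) : ∃ r, R ≤ r ∧ block r a z ∈ admissible 𝔄 r := by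
  by_contra! h
  have h1 : energy 𝔄 a z ≤ ((R - 1 : ℕ) : ℕ∞) := by
    refine iSup₂_le fun r hr => Nat.cast_le.mpr ?_
    by_contra h'
    exact h r (by omega) hr
  have h2 : (R : ℕ∞) ≤ ((R - 1 : ℕ) : ℕ∞) := le_trans hz h1
  have := Nat.cast_le.mp h2
  omega

/-- The form in which unflawedness is used: around `z`, the configuration cannot be distinguished
from an element of `𝔄`. -/
theorem exists_block_eq {𝔄 : Subshift A (Lat D)} {a : Lat D → A} {R : ℕ} (hR : 0 < R)
    {z : Lat D} (hz : z ∈ unflawed 𝔄 a R) : ∃ b : 𝔄.carrier, block R b.1 z = block R a z := by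
  obtain ⟨r, hr, b, hb, h⟩ := exists_le_of_mem_unflawed hR hz
  refine ⟨shiftOn 𝔄 (-z) ⟨b, hb⟩, ?_⟩
  refine Eq.trans ?_ (block_eq_of_le hr h)
  exact (block_shift R b (-z) z).trans (by rw [neg_add_cancel])

theorem mem_unflawed_of_block_eq {𝔄 : Subshift A (Lat D)} {a : Lat D → A} {R : ℕ} {z : Lat D}
    {b : Lat D → A} (hb : b ∈ 𝔄.carrier) (h : block R b z = block R a z) :
    z ∈ unflawed 𝔄 a R := by
  have : block R a z ∈ admissible 𝔄 R :=
    ⟨shift z b, 𝔄.mapsTo z hb, by rw [block_shift, add_zero, h]⟩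
  exact le_iSup₂_of_le (f := fun (r : ℕ) (_ : block r a z ∈ admissible 𝔄 r) => (r : ℕ∞)) R this
    le_rfl

/-- The defect field is `1`-Lipschitz for the sup metric. -/
theorem add_mem_unflawed {𝔄 : Subshift A (Lat D)} {a : Lat D → A} {r s : ℕ} (hr : 0 < s + r)
    {z u : Lat D} (hz : z ∈ unflawed 𝔄 a (s + r)) (hu : u ∈ box D s) :
    z + u ∈ unflawed 𝔄 a r := by
  obtain ⟨b, hb⟩ := exists_block_eq hr hz
  exact mem_unflawed_of_block_eq b.2 (block_eq_of_sub_mem hb (by simpa using hu) le_rfl)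

end Lattice

/-! ## Trails -/

section Trails

variable {D : ℕ} {A G : Type*} [Group G]

theorem Trail.value_append {s : ℕ} (c : Lat D → (box D s → A) → G) (a : Lat D → A)
    {x y z : Lat D} (ζ : Trail x y) (ξ : Trail y z) :
    Trail.value c a (SimpleGraph.Walk.append ζ ξ) = Trail.value c a ξ * Trail.value c a ζ := by
  induction ζ with
  | nil => simp [Trail.value]
  | cons h p ih =>
    rw [SimpleGraph.Walk.cons_append]
    simp only [Trail.value, ih, mul_assoc]

/-- A rule reads only the `s`-blocks at the vertices. This permits replacing `a` by a configuration
of the subshift along a trail. -/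
theorem Trail.value_congr {s : ℕ} (c : Lat D → (box D s → A) → G) {a a' : Lat D → A}
    {y z : Lat D} (ζ : Trail y z)
    (h : ∀ v ∈ SimpleGraph.Walk.support ζ, block s a v = block s a' v) :
    Trail.value c a ζ = Trail.value c a' ζ := by
  induction ζ with
  | nil => rfl
  | cons e p ih =>
    simp only [SimpleGraph.Walk.support_cons, List.mem_cons, forall_eq_or_imp] at h
    simp only [Trail.value, ih h.2, h.1]

theorem Trail.inSet_cons_iff {S : Set (Lat D)} {x y z : Lat D} (h : (latGraph D).Adj x y)
    (p : Trail y z) : Trail.InSet (SimpleGraph.Walk.cons h p : Trail x z) S ↔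
      x ∈ S ∧ p.InSet S := by
  simp [Trail.InSet, SimpleGraph.Walk.support_cons]

theorem Trail.InSet.append {S : Set (Lat D)} {x y z : Lat D} {ζ : Trail x y} {ξ : Trail y z}
    (hζ : ζ.InSet S) (hξ : ξ.InSet S) :
    Trail.InSet (SimpleGraph.Walk.append ζ ξ : Trail x z) S := by
  intro v hv
  rcases (SimpleGraph.Walk.mem_support_append_iff ζ ξ).mp hv with h | h
  exacts [hζ v h, hξ v h]

/-- Any two corners of a cube are joined by a trail through corners of the cube. -/
theorem exists_trail_corners {c v w : Lat D} (hv : v ∈ corners c) (hw : w ∈ corners c) :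
    ∃ ζ : Trail v w, ζ.InSet (corners c) := by
  classical
  -- Induction on the number of coordinates in which the two corners differ; correcting one of them
  -- is a unit step between corners.
  induction h : (Finset.univ.filter fun i => v i ≠ w i).card generalizing v with
  | zero =>
    have : v = w := by
      funext i
      by_contra hi
      have : i ∈ (Finset.univ.filter fun i => v i ≠ w i) := by simp [hi]
      rw [Finset.card_eq_zero.mp h] at this
      simp at this
    subst this
    exact ⟨.nil, fun u hu => by
      rw [SimpleGraph.Walk.support_nil, List.mem_singleton] at hu
      exact hu ▸ hv⟩
  | succ n ih =>
    obtain ⟨i, hi⟩ := Finset.card_pos.mp (h.symm ▸ Nat.succ_pos n :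
      0 < (Finset.univ.filter fun i => v i ≠ w i).card)
    have hne : v i ≠ w i := (Finset.mem_filter.mp hi).2
    have hu : Function.update v i (w i) ∈ corners c := fun j => by
      rcases eq_or_ne j i with rfl | hj
      · simpa using hw j
      · simpa [hj] using hv j
    have hcard : (Finset.univ.filter fun j => Function.update v i (w i) j ≠ w j).card = n := by
      have : (Finset.univ.filter fun j => Function.update v i (w i) j ≠ w j) =
          (Finset.univ.filter fun j => v j ≠ w j).erase i := by
        ext j
        rcases eq_or_ne j i with rfl | hj <;> simp [*]
      rw [this, Finset.card_erase_of_mem hi, h, Nat.add_sub_cancel]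
    obtain ⟨ζ, hζ⟩ := ih hu hcard
    have hadj : (latGraph D).Adj v (Function.update v i (w i)) := by
      refine ⟨i, ?_⟩
      have h1 : Function.update v i (w i) - v = Pi.single i (w i - v i) := by
        funext j
        rcases eq_or_ne j i with rfl | hj <;> simp [*]
      have h2 : w i - v i = 1 ∨ w i - v i = -1 := by
        rcases hv i with h | h <;> rcases hw i with h' | h' <;> omega
      rw [h1]
      exact h2.imp (fun h => by rw [h]) (fun h => by rw [h])
    exact ⟨.cons hadj ζ, (Trail.inSet_cons_iff hadj ζ).mpr ⟨hv, hζ⟩⟩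

theorem sub_mem_box_of_corners {c v w : Lat D} (hv : v ∈ corners c) (hw : w ∈ corners c) :
    w - v ∈ box D 1 := fun i => by
  rw [Pi.sub_apply, abs_le]
  rcases hv i with h | h <;> rcases hw i with h' | h' <;> constructor <;> push_cast <;> omega

end Trails

/-! ## Cocycles and local rules -/

section LocalRules

variable {D : ℕ} {A : Type*} [TopologicalSpace A] {𝔄 : Subshift A (Lat D)} {G : Type*}

theorem shiftOn_add (y z : Lat D) (b : 𝔄.carrier) :
    shiftOn 𝔄 (y + z) b = shiftOn 𝔄 z (shiftOn 𝔄 y b) :=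
  Subtype.ext (shift_add y z b.1)

theorem block_shiftOn (s : ℕ) (z : Lat D) (b : 𝔄.carrier) :
    block s (shiftOn 𝔄 z b).1 0 = block s b.1 z := by
  refine (block_shift s b.1 z 0).trans ?_
  rw [add_zero]

/-- On a configuration of the subshift, the value of a local rule along a trail is the value of the
cocycle. -/
theorem value_eq_cocycle [Group G] [TopologicalSpace G] {C : Lat D → 𝔄.carrier → G}
    (hC : C ∈ cocycles 𝔄 G) {s : ℕ} {c : Lat D → (box D s → A) → G} (hc : IsLocalRule 𝔄 C s c)
    (b : 𝔄.carrier) {v w : Lat D} (ζ : Trail v w) :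
    Trail.value c b.1 ζ = C (w - v) (shiftOn 𝔄 v b) := by
  induction ζ with
  | nil =>
    rename_i u
    -- The cocycle equation at `0 + 0` makes `C 0` idempotent, hence trivial.
    have := hC.2 0 0 (shiftOn 𝔄 u b)
    rw [← shiftOn_add, add_zero, add_zero] at this
    rw [sub_self]
    exact (mul_eq_left.mp this.symm).symm
  | cons h p ih =>
    rename_i v u w
    have h1 := hc (u - v) h (shiftOn 𝔄 v b)
    rw [block_shiftOn] at h1
    rw [Trail.value, ih, h1, ← sub_add_sub_cancel w u v, hC.2, ← shiftOn_add, add_sub_cancel]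

/-- The value depends only on the end points, so it is that of the trivial trail. This is what makes
residues of removable defects vanish. -/
theorem value_closed_eq_one [Group G] [TopologicalSpace G] {C : Lat D → 𝔄.carrier → G}
    (hC : C ∈ cocycles 𝔄 G) {s : ℕ} {c : Lat D → (box D s → A) → G} (hc : IsLocalRule 𝔄 C s c)
    (b : 𝔄.carrier) {v : Lat D} (ζ : Trail v v) : Trail.value c b.1 ζ = 1 := by
  rw [value_eq_cocycle hC hc b ζ, sub_self, ← sub_self v,
    ← value_eq_cocycle hC hc b (.nil : Trail v v)]
  rfl

theorem continuous_cocycle [Group G] [TopologicalSpace G] {C : Lat D → 𝔄.carrier → G}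
    (hC : C ∈ cocycles 𝔄 G) (z : Lat D) : Continuous (C z) :=
  hC.1.comp (Continuous.prodMk_right z)

variable [Finite A] [DiscreteTopology A]

/-- A continuous map from a subshift to a discrete space depends on finitely many coordinates. -/
theorem exists_radius {X : Type*} [TopologicalSpace X] [DiscreteTopology X]
    {f : 𝔄.carrier → X} (hf : Continuous f) :
    ∃ s : ℕ, ∀ b b' : 𝔄.carrier, block s b.1 0 = block s b'.1 0 → f b = f b' := by
  have hopen : ∀ (n : ℕ) (b : 𝔄.carrier),
      IsOpen {b' : 𝔄.carrier | block n b'.1 0 = block n b.1 0} := fun n b => by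
    have : Finite (box D n) := finite_box D n
    have hcont : Continuous fun b' : 𝔄.carrier => block n b'.1 0 :=
      continuous_pi fun u => (continuous_apply _).comp continuous_subtype_val
    exact (isOpen_discrete {block n b.1 0}).preimage hcont
  have hloc : ∀ b : 𝔄.carrier, ∃ n : ℕ, ∀ b' : 𝔄.carrier,
      block n b'.1 0 = block n b.1 0 → f b' = f b := fun b => by
    obtain ⟨V, hV, hVf⟩ := isOpen_induced_iff.mp ((isOpen_discrete {f b}).preimage hf)
    have hbV : b.1 ∈ V := by
      have : b ∈ f ⁻¹' {f b} := rfl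
      rwa [← hVf] at this
    obtain ⟨F, u, hu, hF⟩ := isOpen_pi_iff.mp hV b.1 hbV
    -- A radius whose box contains the finite set `F` of coordinates that determine a basic
    -- neighbourhood of `b`.
    refine ⟨F.sup fun z => Finset.univ.sup fun i => (z i).natAbs, fun b' hb' => ?_⟩
    have : b' ∈ Subtype.val ⁻¹' V := hF fun z hz => by
      have hzb : z ∈ box D (F.sup fun z => Finset.univ.sup fun i => (z i).natAbs) := fun i => by
        have h1 : (z i).natAbs ≤ Finset.univ.sup fun i => (z i).natAbs :=
          Finset.le_sup (f := fun i => (z i).natAbs) (Finset.mem_univ i)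
        have h2 := h1.trans
          (Finset.le_sup (f := fun z : Lat D => Finset.univ.sup fun i => (z i).natAbs) hz)
        rw [Int.abs_eq_natAbs]
        exact_mod_cast h2
      have h3 := block_eq_iff.mp hb' z hzb
      rw [zero_add] at h3
      rw [h3]
      exact (hu z hz).2
    rw [hVf] at this
    exact this
  choose n hn using hloc
  have : CompactSpace 𝔄.carrier := isCompact_iff_compactSpace.mp 𝔄.isClosed.isCompact
  obtain ⟨t, ht⟩ := isCompact_univ.elim_finite_subcover
    (fun b : 𝔄.carrier => {b' : 𝔄.carrier | block (n b) b'.1 0 = block (n b) b.1 0})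
    (fun b => hopen _ b) (fun b _ => Set.mem_iUnion.mpr ⟨b, rfl⟩)
  -- The largest radius in the finite subcover: configurations with equal blocks of this radius lie
  -- in a common cylinder of the cover.
  refine ⟨t.sup n, fun b b' h => ?_⟩
  obtain ⟨b₀, hb₀, hb⟩ := Set.mem_iUnion₂.mp (ht (Set.mem_univ b))
  have h' := block_eq_of_le (Finset.le_sup hb₀ : n b₀ ≤ t.sup n) h
  rw [hn b₀ b hb, hn b₀ b' (h'.symm.trans hb)]

theorem exists_isLocalRule [Group G] [TopologicalSpace G] [DiscreteTopology G]
    {C : Lat D → 𝔄.carrier → G} (hC : C ∈ cocycles 𝔄 G) :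
    ∃ s c, IsLocalRule 𝔄 C s c := by
  classical
  choose n hn using fun e => exists_radius (continuous_cocycle hC e)
  -- One radius serves the finitely many unit steps. On an admissible block any extension `b` gives
  -- the same value; elsewhere the default `1` is harmless.
  refine ⟨(finite_unitSteps D).toFinset.sup n, fun e w =>
    if h : ∃ b : 𝔄.carrier, block _ b.1 0 = w then C e h.choose else 1, fun e he b => ?_⟩
  have h : ∃ b' : 𝔄.carrier, block ((finite_unitSteps D).toFinset.sup n) b'.1 0 =
      block _ b.1 0 := ⟨b, rfl⟩
  refine (dif_pos h).trans ?_
  exact hn e _ _ (block_eq_of_le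
    (Finset.le_sup ((finite_unitSteps D).mem_toFinset.mpr he)) h.choose_spec)

end LocalRules

/-! ### Common radii and products of local rules -/

section Enlarge

variable {D : ℕ} {A G : Type*}

/-- A local rule of radius `s` regarded as a rule of radius `s' ≥ s`. -/
def enlarge {s s' : ℕ} (h : s ≤ s') (c : Lat D → (box D s → A) → G) :
    Lat D → (box D s' → A) → G :=
  fun e w => c e fun u => w ⟨u, box_mono h u.2⟩

theorem isLocalRule_enlarge [TopologicalSpace A] {𝔄 : Subshift A (Lat D)}
    {C : Lat D → 𝔄.carrier → G} {s s' : ℕ} (h : s ≤ s') {c : Lat D → (box D s → A) → G}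
    (hc : IsLocalRule 𝔄 C s c) : IsLocalRule 𝔄 C s' (enlarge h c) :=
  hc

theorem value_mul [CommGroup G] {s : ℕ} (c c' : Lat D → (box D s → A) → G)
    (a : Lat D → A) {y z : Lat D} (ζ : Trail y z) :
    Trail.value (fun e w => c e w * c' e w) a ζ = Trail.value c a ζ * Trail.value c' a ζ := by
  induction ζ with
  | nil => simp [Trail.value]
  | cons e p ih =>
    simp only [Trail.value, ih]
    exact mul_mul_mul_comm _ _ _ _

end Enlarge

/-- Local rules of cohomologous cocycles have conjugate values along closed trails in an unflawed
region of large range. -/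
theorem exists_value_eq_of_cohomologous {D : ℕ} {A : Type*} [TopologicalSpace A] [Finite A]
    [DiscreteTopology A] {𝔄 : Subshift A (Lat D)} {G : Type*} [Group G] [TopologicalSpace G]
    [DiscreteTopology G] (a : Lat D → A) {C C' : Lat D → 𝔄.carrier → G}
    (h : Cohomologous 𝔄 C C') {s s' : ℕ} {c : Lat D → (box D s → A) → G}
    {c' : Lat D → (box D s' → A) → G} (hc : IsLocalRule 𝔄 C s c) (hc' : IsLocalRule 𝔄 C' s' c') :
    ∃ N : ℕ, ∀ R, N ≤ R → ∃ g : Lat D → G, ∀ (y z : Lat D) (ζ : Trail y z),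
      ζ.InSet (unflawed 𝔄 a R) →
        Trail.value c' a ζ = g z * Trail.value c a ζ * (g y)⁻¹ := by
  classical
  obtain ⟨f, hf, hfC⟩ := h
  obtain ⟨n, hn⟩ := exists_radius hf
  -- The range covers both rules and leaves room for the transfer function, of radius `n`, to be
  -- read one step away from the centre of a block.
  refine ⟨n + s + s' + 1, fun R hR => ?_⟩
  have hex : ∀ z ∈ unflawed 𝔄 a R, ∃ b : 𝔄.carrier, block R b.1 z = block R a z :=
    fun z hz => exists_block_eq (by omega) hz
  rcases (unflawed 𝔄 a R).eq_empty_or_nonempty with hempty | ⟨z₀, hz₀⟩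
  · exact ⟨1, fun y z ζ hζ =>
      (hempty ▸ hζ y (SimpleGraph.Walk.start_mem_support ζ) : y ∈ (∅ : Set (Lat D))).elim⟩
  have : Nonempty 𝔄.carrier := ⟨(hex z₀ hz₀).choose⟩
  choose! b hb using hex
  have key : ∀ z ∈ unflawed 𝔄 a R, ∀ z' ∈ unflawed 𝔄 a R, z' - z ∈ unitSteps D →
      c' (z' - z) (block s' a z) =
        f (shiftOn 𝔄 z' (b z')) * c (z' - z) (block s a z) * (f (shiftOn 𝔄 z (b z)))⁻¹ := by
    intro z hz z' hz' he
    have h1 := hc _ he (shiftOn 𝔄 z (b z))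
    have h2 := hc' _ he (shiftOn 𝔄 z (b z))
    rw [block_shiftOn, block_eq_of_le (by omega : s ≤ R) (hb z hz)] at h1
    rw [block_shiftOn, block_eq_of_le (by omega : s' ≤ R) (hb z hz)] at h2
    -- The models `b z` and `b z'` both agree with `a` on the `n`-box at `z'`, so the transfer
    -- function has the same value there and the product along the trail telescopes.
    have h3 : f (shiftOn 𝔄 (z' - z) (shiftOn 𝔄 z (b z))) = f (shiftOn 𝔄 z' (b z')) := by
      refine hn _ _ ?_
      rw [← shiftOn_add, add_sub_cancel, block_shiftOn, block_shiftOn,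
        block_eq_of_sub_mem (hb z hz) (unitSteps_subset_box he) (by omega : 1 + n ≤ R),
        block_eq_of_le (by omega : n ≤ R) (hb z' hz')]
    rw [h1, h2, hfC, h3]
  refine ⟨fun z => f (shiftOn 𝔄 z (b z)), fun y z ζ hζ => ?_⟩
  induction ζ with
  | nil => simp [Trail.value]
  | cons e p ih =>
    rw [Trail.inSet_cons_iff] at hζ
    have hv := hζ.2 _ (SimpleGraph.Walk.start_mem_support p)
    simp only [Trail.value]
    rw [ih hζ.2, key _ hζ.1 _ hv e]
    group

/-! ## Paths in subspaces -/

section Restrict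

variable {X : Type*} [TopologicalSpace X] {W : Set X} {p q r : X}

/-- A path in `W`, as a path in the subspace `W`. -/
def pathInto (γ : Path p q) (h : ∀ t, γ t ∈ W) (hp : p ∈ W) (hq : q ∈ W) :
    Path (⟨p, hp⟩ : W) ⟨q, hq⟩ where
  toFun t := ⟨γ t, h t⟩
  continuous_toFun := γ.continuous.subtype_mk h
  source' := Subtype.ext γ.source
  target' := Subtype.ext γ.target

theorem pathInto_trans (γ : Path p q) (γ' : Path q r) (h : ∀ t, γ t ∈ W) (h' : ∀ t, γ' t ∈ W)
    (h'' : ∀ t, γ.trans γ' t ∈ W) (hp : p ∈ W) (hq : q ∈ W) (hr : r ∈ W) :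
    pathInto (γ.trans γ') h'' hp hr = (pathInto γ h hp hq).trans (pathInto γ' h' hq hr) := by
  ext t
  simp only [pathInto, Path.trans_apply, Path.coe_mk', ContinuousMap.coe_mk]
  split_ifs <;> rfl

theorem trans_mem_iff (γ : Path p q) (γ' : Path q r) :
    (∀ t, γ.trans γ' t ∈ W) ↔ (∀ t, γ t ∈ W) ∧ ∀ t, γ' t ∈ W := by
  rw [← Set.range_subset_iff, ← Set.range_subset_iff, ← Set.range_subset_iff, Path.trans_range,
    Set.union_subset_iff]

end Restrict

/-- Paths with the same end points in a star convex subset are homotopic. -/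
theorem homotopic_of_starConvex {E : Type*} [AddCommGroup E] [Module ℝ E] [TopologicalSpace E]
    [ContinuousAdd E] [ContinuousSMul ℝ E] {X W : Set E} {v : E} (hW : StarConvex ℝ v W)
    (hWX : W ⊆ X) {p q : X} {γ γ' : Path p q} (h : ∀ t, (γ t : E) ∈ W)
    (h' : ∀ t, (γ' t : E) ∈ W) : γ.Homotopic γ' := by
  have hp : (p : E) ∈ W := γ.source ▸ h 0
  have hq : (q : E) ∈ W := γ.target ▸ h 1
  have : ContractibleSpace W := hW.contractibleSpace ⟨_, hp⟩
  have key : (pathInto (γ.map continuous_subtype_val) h hp hq).Homotopic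
      (pathInto (γ'.map continuous_subtype_val) h' hp hq) :=
    SimplyConnectedSpace.paths_homotopic _ _
  exact key.map ⟨Set.inclusion hWX, continuous_inclusion hWX⟩

/-! ## Cubes and open stars -/

section Cubes

variable {D : ℕ}

theorem cube_eq_Icc (z : Lat D) : cube z = Set.Icc (toReal z) (fun i => (z i : ℝ) + 1) := by
  ext p
  exact ⟨fun h => ⟨fun i => (h i).1, fun i => (h i).2⟩, fun h i => ⟨h.1 i, h.2 i⟩⟩

theorem convex_cube (z : Lat D) : Convex ℝ (cube z) :=
  cube_eq_Icc z ▸ convex_Icc _ _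

theorem toReal_mem_cube {v z : Lat D} (hv : v ∈ corners z) : toReal v ∈ cube z := fun i => by
  rcases hv i with h | h <;> simp [toReal, h]

theorem cube_subset_realization {S : Set (Lat D)} {z : Lat D} (h : corners z ⊆ S) :
    cube z ⊆ realization S :=
  fun _ hp => ⟨z, h, hp⟩

/-- The open star of a lattice point. -/
def openStar (v : Lat D) : Set (Fin D → ℝ) := {p | ∀ i, |p i - v i| < 1}

theorem openStar_eq_pi (v : Lat D) :
    openStar v = Set.univ.pi fun i => Set.Ioo ((v i : ℝ) - 1) (v i + 1) := by
  ext p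
  simp only [openStar, Set.mem_ofPred_eq, Set.mem_univ_pi, Set.mem_Ioo, abs_lt]
  exact forall_congr' fun i =>
    ⟨fun h => ⟨by linarith, by linarith⟩, fun h => ⟨by linarith, by linarith⟩⟩

theorem isOpen_openStar (v : Lat D) : IsOpen (openStar v) :=
  openStar_eq_pi v ▸ isOpen_set_pi Set.finite_univ fun _ _ => isOpen_Ioo

theorem convex_openStar (v : Lat D) : Convex ℝ (openStar v) :=
  openStar_eq_pi v ▸ convex_pi fun _ _ => convex_Ioo _ _

theorem toReal_mem_openStar_iff {v w : Lat D} : toReal w ∈ openStar v ↔ w = v := by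
  refine ⟨fun h => funext fun i => ?_, fun h i => by simp [toReal, h]⟩
  have h1 : |((w i - v i : ℤ) : ℝ)| < 1 := by
    push_cast
    exact h i
  rw [← Int.cast_abs] at h1
  have h2 : |w i - v i| < 1 := by exact_mod_cast h1
  have := Int.abs_lt_one_iff.mp h2
  omega

theorem toReal_mem_openStar (v : Lat D) : toReal v ∈ openStar v :=
  toReal_mem_openStar_iff.mpr rfl

/-- The lattice point below a point of `ℝ^D`. -/
noncomputable def floorPt (p : Fin D → ℝ) : Lat D := fun i => ⌊p i⌋

theorem mem_openStar_floorPt (p : Fin D → ℝ) : p ∈ openStar (floorPt p) := fun i => by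
  rw [abs_lt]
  constructor
  · have := Int.floor_le (p i)
    change -1 < p i - (⌊p i⌋ : ℝ)
    linarith
  · have := Int.lt_floor_add_one (p i)
    change p i - (⌊p i⌋ : ℝ) < 1
    linarith

theorem floorPt_toReal (v : Lat D) : floorPt (toReal v) = v :=
  (toReal_mem_openStar_iff.mp (mem_openStar_floorPt (toReal v))).symm

/-- A cube that meets the open star of `v` has `v` as a corner. -/
theorem mem_corners_of_mem_openStar {p : Fin D → ℝ} {v z : Lat D} (hp : p ∈ cube z)
    (hv : p ∈ openStar v) : v ∈ corners z := fun i => by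
  have h1 := abs_lt.mp (hv i)
  have h2 := hp i
  have h3 : (v i : ℝ) < ((z i + 2 : ℤ) : ℝ) := by push_cast; linarith
  have h4 : ((z i - 1 : ℤ) : ℝ) < (v i : ℝ) := by push_cast; linarith
  have h5 := Int.cast_lt.mp h3
  have h6 := Int.cast_lt.mp h4
  omega

theorem mem_of_toReal_mem_realization {S : Set (Lat D)} {v : Lat D}
    (h : toReal v ∈ realization S) : v ∈ S := by
  obtain ⟨z, hz, hv⟩ := h
  exact hz (mem_corners_of_mem_openStar hv (toReal_mem_openStar v))

/-- Each cube of the realization that meets the star has `v` as a corner, so it meets the star in a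
convex set containing `v`. Their union need not be convex, only star convex. -/
theorem starConvex_openStar_inter (S : Set (Lat D)) (v : Lat D) :
    StarConvex ℝ (toReal v) (openStar v ∩ realization S) := by
  rw [starConvex_iff_segment_subset]
  rintro p ⟨hp, z, hz, hpz⟩
  have hv := toReal_mem_cube (mem_corners_of_mem_openStar hpz hp)
  exact Set.subset_inter ((convex_openStar v).segment_subset (toReal_mem_openStar v) hp)
    (((convex_cube z).segment_subset hv hpz).trans (cube_subset_realization hz))

end Cubes

/-! ## Trails as paths in the realization -/

section TrailPaths

variable {D : ℕ} {S : Set (Lat D)}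

/-- The path traced out by a trail, in the realization of `S`. -/
noncomputable def Trail.pathIn {y z : Lat D} (ζ : Trail y z)
    (h : ∀ t, ζ.path t ∈ realization S) (hy : toReal y ∈ realization S)
    (hz : toReal z ∈ realization S) :
    Path (⟨toReal y, hy⟩ : realization S) ⟨toReal z, hz⟩ :=
  pathInto ζ.path h hy hz

theorem segment_mem_of_convex {W : Set (Fin D → ℝ)} (hW : Convex ℝ W) {p q : Fin D → ℝ}
    (hp : p ∈ W) (hq : q ∈ W) (t : I) : Path.segment p q t ∈ W := by
  have : Path.segment p q t ∈ Set.range (Path.segment p q) := ⟨t, rfl⟩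
  rw [Path.range_segment] at this
  exact hW.segment_subset hp hq this

theorem Trail.path_mem_cube {y z c : Lat D} (ζ : Trail y z) (h : ζ.InSet (corners c)) (t : I) :
    ζ.path t ∈ cube c := by
  induction ζ generalizing t with
  | nil =>
    rename_i u
    exact toReal_mem_cube (h u (by simp))
  | cons e p ih =>
    rw [Trail.inSet_cons_iff] at h
    refine (trans_mem_iff _ _).mpr ⟨fun t => ?_, ih h.2⟩ t
    exact segment_mem_of_convex (convex_cube c) (toReal_mem_cube h.1)
      (toReal_mem_cube (h.2 _ (SimpleGraph.Walk.start_mem_support p))) t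

/-- The equality is one of homotopy classes because concatenation of paths is associative only up to
homotopy. -/
theorem Trail.pathIn_append {x y z : Lat D} (ζ : Trail x y) (ξ : Trail y z)
    (hζ : ∀ t, ζ.path t ∈ realization S) (hξ : ∀ t, ξ.path t ∈ realization S)
    (hx : toReal x ∈ realization S) (hy : toReal y ∈ realization S)
    (hz : toReal z ∈ realization S) :
    ∃ h : ∀ t, Trail.path (SimpleGraph.Walk.append ζ ξ) t ∈ realization S,
      Path.Homotopic.Quotient.mk (Trail.pathIn (SimpleGraph.Walk.append ζ ξ) h hx hz) =
        (Path.Homotopic.Quotient.mk (ζ.pathIn hζ hx hy)).trans (.mk (ξ.pathIn hξ hy hz)) := by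
  induction ζ with
  | nil =>
    refine ⟨hξ, ?_⟩
    have : Trail.pathIn .nil hζ hx hy = Path.refl _ := rfl
    rw [this, Path.Homotopic.Quotient.mk_refl, Path.Homotopic.Quotient.refl_trans]
    rfl
  | cons e p ih =>
    have hsplit := (trans_mem_iff _ _).mp hζ
    obtain ⟨h, hh⟩ := ih ξ hsplit.2 hξ (by simpa using hsplit.1 1) hy
    have h' := (trans_mem_iff _ _).mpr ⟨hsplit.1, h⟩
    refine ⟨h', ?_⟩
    have e1 := pathInto_trans _ _ hsplit.1 h h' hx (by simpa using hsplit.1 1) hz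
    have e2 := pathInto_trans _ _ hsplit.1 hsplit.2 hζ hx (by simpa using hsplit.1 1) hy
    refine (congrArg Path.Homotopic.Quotient.mk e1).trans ?_
    rw [Path.Homotopic.Quotient.mk_trans]
    refine (congrArg _ hh).trans ?_
    rw [← Path.Homotopic.Quotient.trans_assoc, ← Path.Homotopic.Quotient.mk_trans]
    exact congrArg (fun γ => Path.Homotopic.Quotient.trans (.mk γ) _) e2.symm

theorem segment_mem_realization {v : Lat D} {p : realization S} (h : p.1 ∈ openStar v) (t : I) :
    Path.segment p.1 (toReal v) t ∈ realization S := by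
  obtain ⟨z, hz, hpz⟩ := p.2
  exact cube_subset_realization hz (segment_mem_of_convex (convex_cube z) hpz
    (toReal_mem_cube (mem_corners_of_mem_openStar hpz h)) t)

theorem toReal_mem_realization {v : Lat D} {p : realization S} (h : p.1 ∈ openStar v) :
    toReal v ∈ realization S := by
  simpa using segment_mem_realization h 1

/-- The segment from a point of the realization to the centre of an open star around it. -/
noncomputable def toCentre {v : Lat D} {p : realization S} (h : p.1 ∈ openStar v) :
    Path p ⟨toReal v, toReal_mem_realization h⟩ :=
  pathInto (Path.segment p.1 (toReal v)) (segment_mem_realization h) p.2 _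

theorem toCentre_mem_cube {v z : Lat D} {p : realization S} (h : p.1 ∈ openStar v)
    (hz : p.1 ∈ cube z) (t : I) : (toCentre h t).1 ∈ cube z :=
  segment_mem_of_convex (convex_cube z) hz
    (toReal_mem_cube (mem_corners_of_mem_openStar hz h)) t

theorem toCentre_mem_openStar {v : Lat D} {p : realization S} (h : p.1 ∈ openStar v) (t : I) :
    (toCentre h t).1 ∈ openStar v :=
  segment_mem_of_convex (convex_openStar v) h (toReal_mem_openStar v) t

/-! ## Cellular approximation -/

/-- A homotopy class of paths is cellular if it is the class of a trail, up to segments to nearby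
lattice points. -/
def IsCellular {p q : realization S} (γ : Path.Homotopic.Quotient p q) : Prop :=
  ∀ (v w : Lat D) (hv : p.1 ∈ openStar v) (hw : q.1 ∈ openStar w),
    ∃ ζ : Trail v w, ζ.InSet S ∧ ∃ h : ∀ t, ζ.path t ∈ realization S,
      γ = ((Path.Homotopic.Quotient.mk (toCentre hv)).trans (.mk (ζ.pathIn h _ _))).trans
        (.symm (.mk (toCentre hw)))

theorem IsCellular.trans {p q r : realization S} {γ : Path.Homotopic.Quotient p q}
    {γ' : Path.Homotopic.Quotient q r}
    (hγ : IsCellular γ) (hγ' : IsCellular γ') : IsCellular (γ.trans γ') := by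
  intro v w hv hw
  -- Cellularity allows any choice of nearby lattice points, so both trails can be made to meet at
  -- the floor of `q`; the two segments between it and `q` cancel.
  have hu := mem_openStar_floorPt q.1
  obtain ⟨ζ, hζ, h, e⟩ := hγ v _ hv hu
  obtain ⟨ζ', hζ', h', e'⟩ := hγ' _ w hu hw
  obtain ⟨h'', e''⟩ := Trail.pathIn_append ζ ζ' h h' (toReal_mem_realization hv)
    (toReal_mem_realization hu) (toReal_mem_realization hw)
  refine ⟨SimpleGraph.Walk.append ζ ζ', hζ.append hζ', h'', ?_⟩
  rw [e'', e, e']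
  simp only [Path.Homotopic.Quotient.trans_assoc]
  congr 2
  rw [← Path.Homotopic.Quotient.trans_assoc (Path.Homotopic.Quotient.symm _),
    Path.Homotopic.Quotient.symm_trans, Path.Homotopic.Quotient.refl_trans]

/-- The trail goes from `v` to `u` through corners of a cube containing `p`, then to `w` through
corners of a cube containing `q`. Convexity of these cubes contracts its two halves to segments
(`e1`, `e2`), and star convexity around `u` contracts the path itself to `p → u → q` (`e3`). -/
theorem isCellular_of_mem_openStar {u : Lat D} {p q : realization S} (γ : Path p q)
    (h : ∀ t, (γ t).1 ∈ openStar u) : IsCellular (Path.Homotopic.Quotient.mk γ) := by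
  intro v w hv hw
  have hp : p.1 ∈ openStar u := by simpa using h 0
  have hq : q.1 ∈ openStar u := by simpa using h 1
  obtain ⟨c, hc, hpc⟩ := id p.2
  obtain ⟨c', hc', hqc'⟩ := id q.2
  obtain ⟨ζ, hζ⟩ := exists_trail_corners (mem_corners_of_mem_openStar hpc hv)
    (mem_corners_of_mem_openStar hpc hp)
  obtain ⟨ξ, hξ⟩ := exists_trail_corners (mem_corners_of_mem_openStar hqc' hq)
    (mem_corners_of_mem_openStar hqc' hw)
  have hζS := fun t => cube_subset_realization hc (ζ.path_mem_cube hζ t)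
  have hξS := fun t => cube_subset_realization hc' (ξ.path_mem_cube hξ t)
  obtain ⟨h', e⟩ := Trail.pathIn_append ζ ξ hζS hξS (toReal_mem_realization hv)
    (toReal_mem_realization hp) (toReal_mem_realization hw)
  refine ⟨SimpleGraph.Walk.append ζ ξ,
    Trail.InSet.append (fun x hx => hc (hζ x hx)) (fun x hx => hc' (hξ x hx)), h', ?_⟩
  have e1 : ((toCentre hv).trans (ζ.pathIn hζS _ (toReal_mem_realization hp))).Homotopic
      (toCentre hp) :=
    homotopic_of_starConvex ((convex_cube c).starConvex hpc) (cube_subset_realization hc)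
      (((trans_mem_iff (W := {x : realization S | x.1 ∈ cube c}) _ _).mpr
        ⟨toCentre_mem_cube hv hpc, ζ.path_mem_cube hζ⟩)) (toCentre_mem_cube hp hpc)
  have e2 : ((ξ.pathIn hξS (toReal_mem_realization hp) _).trans (toCentre hw).symm).Homotopic
      (toCentre hq).symm :=
    homotopic_of_starConvex ((convex_cube c').starConvex hqc') (cube_subset_realization hc')
      (((trans_mem_iff (W := {x : realization S | x.1 ∈ cube c'}) _ _).mpr
        ⟨ξ.path_mem_cube hξ, fun t => toCentre_mem_cube hw hqc' _⟩))
      (fun t => toCentre_mem_cube hq hqc' _)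
  have e3 : γ.Homotopic ((toCentre hp).trans (toCentre hq).symm) :=
    homotopic_of_starConvex (starConvex_openStar_inter S u) Set.inter_subset_right
      (fun t => ⟨h t, (γ t).2⟩)
      (((trans_mem_iff (W := {x : realization S | x.1 ∈ openStar u ∩ realization S}) _ _).mpr
        ⟨fun t => ⟨toCentre_mem_openStar hp t, (toCentre hp t).2⟩,
          fun t => ⟨toCentre_mem_openStar hq _, Subtype.prop _⟩⟩))
  rw [e, Path.Homotopic.Quotient.eq.mpr e3, Path.Homotopic.Quotient.mk_trans,
    ← Path.Homotopic.Quotient.eq.mpr e1, Path.Homotopic.Quotient.mk_trans,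
    ← Path.Homotopic.Quotient.eq.mpr e2, Path.Homotopic.Quotient.mk_trans,
    Path.Homotopic.Quotient.mk_symm]
  simp only [Path.Homotopic.Quotient.trans_assoc]

theorem IsCellular.of_cast {p q p' q' : realization S} (hp : p' = p) (hq : q' = q)
    {γ : Path p q} (h : IsCellular (Path.Homotopic.Quotient.mk (γ.cast hp hq))) :
    IsCellular (Path.Homotopic.Quotient.mk γ) := by
  subst hp hq
  exact h

/-- Cellular approximation for paths: every homotopy class of paths is cellular. -/
theorem isCellular {p q : realization S} (γ : Path.Homotopic.Quotient p q) : IsCellular γ := by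
  induction γ using Path.Homotopic.Quotient.ind with | mk γ => ?_
  -- By compactness of the interval, the path is cut into finitely many pieces, each within one open
  -- star.
  obtain ⟨t, t0, tmono, ⟨N, hN⟩, hsub⟩ :=
    exists_monotone_Icc_subset_open_cover_unitInterval
      (c := fun v : Lat D => {s : I | (γ s).1 ∈ openStar v})
      (fun v => (isOpen_openStar v).preimage (continuous_subtype_val.comp γ.continuous))
      (fun s _ => Set.mem_iUnion.mpr ⟨_, mem_openStar_floorPt (γ s).1⟩)
  have key : ∀ n, IsCellular (Path.Homotopic.Quotient.mk (γ.subpath (t 0) (t n))) := by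
    intro n
    induction n with
    | zero =>
      refine isCellular_of_mem_openStar (u := floorPt (γ (t 0)).1) _ fun s => ?_
      rw [Path.subpath_self]
      exact mem_openStar_floorPt _
    | succ n ih =>
      obtain ⟨v, hv⟩ := hsub n
      have h1 : IsCellular (Path.Homotopic.Quotient.mk (γ.subpath (t n) (t (n + 1)))) := by
        refine isCellular_of_mem_openStar (u := v) _ fun s => ?_
        have : γ.subpath (t n) (t (n + 1)) s ∈ Set.range (γ.subpath (t n) (t (n + 1))) := ⟨s, rfl⟩
        rw [Path.range_subpath_of_le _ _ _ (tmono n.le_succ)] at this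
        obtain ⟨x, hx, e⟩ := this
        rw [← e]
        exact hv hx
      have := ih.trans h1
      rwa [← Path.Homotopic.Quotient.mk_trans, Path.Homotopic.Quotient.eq.mpr
        ⟨Path.Homotopy.subpathTransSubpath γ (t 0) (t n) (t (n + 1))⟩] at this
  have h := key N
  rw [t0, hN N le_rfl, Path.subpath_zero_one] at h
  exact h.of_cast

/-- Every path between lattice points of the realization is homotopic to a trail. -/
theorem exists_trail_of_path {y z : Lat D} (hy : toReal y ∈ realization S)
    (hz : toReal z ∈ realization S)
    (γ : Path.Homotopic.Quotient (⟨toReal y, hy⟩ : realization S) ⟨toReal z, hz⟩) :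
    ∃ ζ : Trail y z, ζ.InSet S ∧ ∃ h : ∀ t, ζ.path t ∈ realization S,
      γ = .mk (ζ.pathIn h hy hz) := by
  obtain ⟨ζ, hζ, h, e⟩ := isCellular γ y z (toReal_mem_openStar y) (toReal_mem_openStar z)
  refine ⟨ζ, hζ, h, ?_⟩
  have hrefl : ∀ {w : Lat D} (hw : toReal w ∈ realization S),
      toCentre (v := w) (p := (⟨toReal w, hw⟩ : realization S)) (toReal_mem_openStar w) =
        Path.refl _ := by
    intro w hw
    ext t
    simp [toCentre, pathInto]
  rw [e, hrefl, hrefl, ← Path.Homotopic.Quotient.mk_symm, Path.refl_symm,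
    Path.Homotopic.Quotient.mk_refl, Path.Homotopic.Quotient.mk_refl,
    Path.Homotopic.Quotient.refl_trans, Path.Homotopic.Quotient.trans_refl]

end TrailPaths

/-! ## Holonomy of locally constant transition functions -/

/-- Locally constant transition functions with values in `G` over an open cover. -/
structure FlatCocycle (ι X G : Type*) [TopologicalSpace X] [Group G] where
  /-- The open cover. -/
  chart : ι → Set X
  isOpen_chart : ∀ i, IsOpen (chart i)
  /-- A chart around each point. -/
  index : X → ι
  mem_chart_index : ∀ x, x ∈ chart (index x)
  /-- The transition functions. -/
  trans : ι → ι → G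
  trans_mul_trans : ∀ i j k x, x ∈ chart i → x ∈ chart j → x ∈ chart k →
    trans j k * trans i j = trans i k

namespace FlatCocycle

variable {ι X G : Type*} [TopologicalSpace X] [Group G] [TopologicalSpace G]
  [DiscreteTopology G] (Φ : FlatCocycle ι X G)

/-- The principal bundle with discrete fibre glued from the transition functions. -/
def core : FiberBundleCore ι X G where
  baseSet := Φ.chart
  isOpen_baseSet := Φ.isOpen_chart
  indexAt := Φ.index
  mem_baseSet_at := Φ.mem_chart_index
  coordChange i j _ g := Φ.trans i j * g
  coordChange_self i x hx g := by
    have := Φ.trans_mul_trans i i i x hx hx hx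
    rw [mul_eq_left.mp this, one_mul]
  continuousOn_coordChange i j :=
    ((continuous_of_discreteTopology (f := fun g : G => Φ.trans i j * g)).comp
      continuous_snd).continuousOn
  coordChange_comp i j k x hx g := by
    rw [← mul_assoc, Φ.trans_mul_trans i j k x hx.1.1 hx.1.2 hx.2]

/-- The fibre is discrete, so the local trivializations exhibit a covering; this is the source of
homotopy invariance. -/
theorem isCoveringMap : IsCoveringMap Φ.core.proj :=
  IsCoveringMap.mk (f := Φ.core.proj) (fun _ => G) (fun x => Φ.core.localTrivAt x)
    (fun x => Φ.core.mem_baseSet_at x)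

/-- A map into the bundle that is locally constant in charts is continuous. -/
theorem continuous_section {Z : Type*} [TopologicalSpace Z] {f : Z → X} (hf : Continuous f)
    (g : Z → G)
    (h : ∀ z₀, ∀ᶠ z in nhds z₀, Φ.trans (Φ.index (f z)) (Φ.index (f z₀)) * g z =
      Φ.trans (Φ.index (f z₀)) (Φ.index (f z₀)) * g z₀) :
    Continuous (fun z => (⟨f z, g z⟩ : Φ.core.TotalSpace)) := by
  refine continuous_iff_continuousAt.mpr fun z₀ => ?_
  have hmem : (⟨f z₀, g z₀⟩ : Φ.core.TotalSpace) ∈ (Φ.core.localTrivAt (f z₀)).source :=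
    (Φ.core.mem_localTrivAt_source _ _).mpr (Φ.core.mem_baseSet_at (f z₀))
  rw [(Φ.core.localTrivAt (f z₀)).toOpenPartialHomeomorph.continuousAt_iff_continuousAt_comp_left]
  · refine hf.continuousAt.prodMk ?_
    refine (continuousAt_const (y := Φ.trans (Φ.index (f z₀)) (Φ.index (f z₀)) * g z₀)).congr ?_
    filter_upwards [h z₀] with z hz
    exact hz.symm
  · have := hf.continuousAt (x := z₀) |>.preimage_mem_nhds
      ((Φ.isOpen_chart _).mem_nhds (Φ.mem_chart_index (f z₀)))
    exact this

/-- The fibre coordinate of a point of the bundle, in the preferred chart. -/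
def coord (x : Φ.core.TotalSpace) : G := x.2

/-- Right translation in the bundle is continuous. -/
theorem continuous_rightTranslation (g : G) :
    Continuous (fun x : Φ.core.TotalSpace => (⟨x.1, Φ.coord x * g⟩ : Φ.core.TotalSpace)) := by
  refine Φ.continuous_section Φ.isCoveringMap.continuous (fun x => Φ.coord x * g) fun x₀ => ?_
  have h1 : (Φ.core.localTrivAt x₀.1).source ∈ nhds x₀ :=
    (Φ.core.localTrivAt x₀.1).open_source.mem_nhds
      ((Φ.core.mem_localTrivAt_source _ _).mpr (Φ.core.mem_baseSet_at x₀.1))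
  have h2 : ContinuousAt (fun x => ((Φ.core.localTrivAt x₀.1) x).2) x₀ :=
    continuous_snd.continuousAt.comp
      ((Φ.core.localTrivAt x₀.1).continuousOn_toFun.continuousAt h1)
  -- The chart coordinate is locally constant since `G` is discrete, and right multiplication
  -- commutes with the left-acting transition functions.
  rw [ContinuousAt, nhds_discrete G, Filter.tendsto_pure] at h2
  filter_upwards [h2] with x hx
  rw [← mul_assoc, ← mul_assoc]
  exact congrArg (· * g) hx

/-- The point of the fibre over `p` with a given coordinate. -/
def fibrePt (p : X) (g : G) : Φ.core.proj ⁻¹' {p} := ⟨⟨p, g⟩, rfl⟩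

theorem fibrePt_injective (p : X) : Function.Injective (Φ.fibrePt p) := fun g g' h => by
  have h1 : (⟨p, g⟩ : Φ.core.TotalSpace) = ⟨p, g'⟩ := congrArg Subtype.val h
  exact congrArg Φ.coord h1

/-- Path lifts are unique, so any continuous lift computes the monodromy. -/
theorem monodromy_of_lift {p q : X} (γ : Path p q) (g : I → G)
    (h : Continuous fun s => (⟨γ s, g s⟩ : Φ.core.TotalSpace)) :
    Φ.isCoveringMap.monodromy (Path.Homotopic.Quotient.mk γ) (Φ.fibrePt p (g 0)) =
      Φ.fibrePt q (g 1) := by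
  refine Subtype.ext ?_
  have h0 : γ 0 = Φ.core.proj (⟨p, g 0⟩ : Φ.core.TotalSpace) := γ.source
  have e0 : (⟨γ 0, g 0⟩ : Φ.core.TotalSpace) = ⟨p, g 0⟩ := by rw [γ.source]
  have e1 : (⟨γ 1, g 1⟩ : Φ.core.TotalSpace) = ⟨q, g 1⟩ := by rw [γ.target]
  have key := (Φ.isCoveringMap.eq_liftPath_iff (γ := (γ : C(I, X))) h0).mpr ⟨h, rfl, e0⟩
  exact (congrFun key 1).symm.trans e1

theorem exists_lift {p q : X} (γ : Path p q) : ∃ g : I → G, g 0 = 1 ∧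
    Continuous fun s => (⟨γ s, g s⟩ : Φ.core.TotalSpace) := by
  obtain ⟨Γ, h1, h2⟩ := Φ.isCoveringMap.exists_path_lifts (γ : C(I, X))
    (⟨p, (1 : G)⟩ : Φ.core.TotalSpace) γ.source
  refine ⟨fun s => Φ.coord (Γ s), congrArg Φ.coord h2, ?_⟩
  have : (fun s => (⟨γ s, Φ.coord (Γ s)⟩ : Φ.core.TotalSpace)) = Γ := by
    funext s
    have h3 : (Γ s).1 = γ s := congrFun h1 s
    rw [← h3]
    rfl
  rw [this]
  exact Γ.continuous

/-- The holonomy along a homotopy class of paths. -/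
noncomputable def holonomy {p q : X} (γ : Path.Homotopic.Quotient p q) : G :=
  Φ.coord (Φ.isCoveringMap.monodromy γ (Φ.fibrePt p 1)).1

/-- Right translation by `(g 0)⁻¹` normalizes the lift to start at `1`. -/
theorem holonomy_mk_mul {p q : X} (γ : Path p q) (g : I → G)
    (h : Continuous fun s => (⟨γ s, g s⟩ : Φ.core.TotalSpace)) :
    Φ.holonomy (.mk γ) * g 0 = g 1 := by
  have h1 := Φ.monodromy_of_lift γ (fun s => g s * (g 0)⁻¹)
    ((Φ.continuous_rightTranslation (g 0)⁻¹).comp h)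
  rw [mul_inv_cancel] at h1
  have h2 : Φ.holonomy (.mk γ) = g 1 * (g 0)⁻¹ := 
    congrArg (fun e : Φ.core.proj ⁻¹' {q} => Φ.coord e.1) h1
  rw [h2, inv_mul_cancel_right]

theorem monodromy_fibrePt {p q : X} (γ : Path.Homotopic.Quotient p q) (g : G) :
    Φ.isCoveringMap.monodromy γ (Φ.fibrePt p g) = Φ.fibrePt q (Φ.holonomy γ * g) := by
  induction γ using Path.Homotopic.Quotient.ind with | mk γ => ?_
  obtain ⟨f, hf, hc⟩ := Φ.exists_lift γ
  have hc' := (Φ.continuous_rightTranslation g).comp hc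
  have h := Φ.monodromy_of_lift γ (fun s => f s * g) hc'
  have h' := Φ.holonomy_mk_mul γ (fun s => f s * g) hc'
  simp only [hf, one_mul] at h h'
  rw [h, h']

/-- Monodromy acts by left multiplication on fibre coordinates, so later paths appear on the left,
as in `Trail.value`. -/
theorem holonomy_trans {p q r : X} (γ : Path.Homotopic.Quotient p q)
    (γ' : Path.Homotopic.Quotient q r) :
    Φ.holonomy (γ.trans γ') = Φ.holonomy γ' * Φ.holonomy γ := by
  have h := Φ.isCoveringMap.monodromy_trans_apply γ γ' (Φ.fibrePt p 1)
  rw [monodromy_fibrePt, monodromy_fibrePt, monodromy_fibrePt, mul_one, mul_one] at h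
  exact Φ.fibrePt_injective r h

theorem holonomy_refl (p : X) : Φ.holonomy (.refl p) = 1 := by
  have h := congrFun (Φ.isCoveringMap.monodromy_refl (x := p)) (Φ.fibrePt p 1)
  rw [monodromy_fibrePt, mul_one] at h
  exact Φ.fibrePt_injective p h

theorem holonomy_symm {p q : X} (γ : Path.Homotopic.Quotient p q) :
    Φ.holonomy γ.symm = (Φ.holonomy γ)⁻¹ := by
  rw [eq_inv_iff_mul_eq_one, ← holonomy_trans, Path.Homotopic.Quotient.trans_symm, holonomy_refl]

/-- The holonomy along a path with a flat section over the charts it meets. -/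
theorem holonomy_mk_of_section {p q : X} (γ : Path p q) (f : ι → G)
    (h : ∀ t i j, γ t ∈ Φ.chart i → γ t ∈ Φ.chart j → Φ.trans i j * f i = f j) :
    Φ.holonomy (.mk γ) * f (Φ.index p) = f (Φ.index q) := by
  have hc : Continuous fun s => (⟨γ s, f (Φ.index (γ s))⟩ : Φ.core.TotalSpace) := by
    refine Φ.continuous_section γ.continuous (fun s => f (Φ.index (γ s))) fun s₀ => ?_
    have : ∀ᶠ s in nhds s₀, γ s ∈ Φ.chart (Φ.index (γ s₀)) :=
      γ.continuous.continuousAt.preimage_mem_nhds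
        ((Φ.isOpen_chart _).mem_nhds (Φ.mem_chart_index _))
    filter_upwards [this] with s hs
    rw [h s _ _ (Φ.mem_chart_index _) hs,
      h s₀ _ _ (Φ.mem_chart_index _) (Φ.mem_chart_index _)]
  have := Φ.holonomy_mk_mul γ _ hc
  rwa [γ.source, γ.target] at this

end FlatCocycle

/-! ## Holonomy of a cocycle over the realization of an unflawed region -/

section Holonomy

variable {D : ℕ} {S : Set (Lat D)} {G : Type*} [Group G]

/-- Transition functions between lattice points that are compatible on each cube of `S` give
transition functions over the cover of the realization by open stars. -/
noncomputable def starCocycle (T : Lat D → Lat D → G)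
    (hT : ∀ z, corners z ⊆ S → ∀ u ∈ corners z, ∀ v ∈ corners z, ∀ w ∈ corners z,
      T v w * T u v = T u w) : FlatCocycle (Lat D) (realization S) G where
  chart v := {p | p.1 ∈ openStar v}
  isOpen_chart v := (isOpen_openStar v).preimage continuous_subtype_val
  index p := floorPt p.1
  mem_chart_index p := mem_openStar_floorPt p.1
  trans := T
  trans_mul_trans u v w p hu hv hw := by
    obtain ⟨z, hz, hp⟩ := p.2
    exact hT z hz u (mem_corners_of_mem_openStar hp hu) v (mem_corners_of_mem_openStar hp hv)
      w (mem_corners_of_mem_openStar hp hw)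

variable [TopologicalSpace G] [DiscreteTopology G]

/-- By multiplicativity it suffices to treat one edge. Its midpoint lies in a cube of `S` and in the
open stars of both end points, so the cube contains the whole edge. There `u ↦ T x u` is a flat
section, which runs from `1` to the value of the rule on the step. -/
theorem starCocycle_holonomy_pathIn {A : Type*} {s : ℕ} {c : Lat D → (box D s → A) → G}
    {a : Lat D → A} (T : Lat D → Lat D → G)
    (hT : ∀ z, corners z ⊆ S → ∀ u ∈ corners z, ∀ v ∈ corners z, ∀ w ∈ corners z,
      T v w * T u v = T u w)
    (hTc : ∀ z, corners z ⊆ S → ∀ v ∈ corners z, ∀ w ∈ corners z, w - v ∈ unitSteps D →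
      T v w = c (w - v) (block s a v))
    {y z : Lat D} (ζ : Trail y z) (h : ∀ t, ζ.path t ∈ realization S)
    (hy : toReal y ∈ realization S) (hz : toReal z ∈ realization S) :
    (starCocycle T hT).holonomy (.mk (ζ.pathIn h hy hz)) = Trail.value c a ζ := by
  induction ζ with
  | nil => exact (starCocycle T hT).holonomy_refl _
  | cons e p ih =>
    rename_i x v w
    have hsplit := (trans_mem_iff _ _).mp h
    have hv : toReal v ∈ realization S := by simpa using hsplit.1 1
    have e1 := pathInto_trans _ _ hsplit.1 hsplit.2 h hy hv hz
    refine (congrArg (fun γ => (starCocycle T hT).holonomy (.mk γ)) e1).trans ?_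
    simp only [Path.Homotopic.Quotient.mk_trans]
    rw [FlatCocycle.holonomy_trans]
    refine congrArg₂ (· * ·) (ih hsplit.2 hv hz) ?_
    obtain ⟨c₀, hc₀, hm⟩ := hsplit.1 ⟨1 / 2, by norm_num, by norm_num⟩
    have hmid : ∀ i, Path.segment (toReal x) (toReal v) ⟨1 / 2, by norm_num, by norm_num⟩ i =
        ((x i : ℝ) + v i) / 2 := fun i => by
      simp [Path.segment_apply, AffineMap.lineMap_apply, toReal]
      ring
    have he : ∀ i, |((v i : ℝ) - x i)| ≤ 1 := fun i => by
      have := unitSteps_subset_box e i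
      have h2 : ((|v i - x i| : ℤ) : ℝ) ≤ ((1 : ℕ) : ℤ) := Int.cast_le.mpr this
      push_cast at h2
      exact h2
    have hx₀ : x ∈ corners c₀ := mem_corners_of_mem_openStar hm fun i => by
      rw [hmid, abs_lt]
      have := abs_le.mp (he i)
      constructor <;> linarith
    have hv₀ : v ∈ corners c₀ := mem_corners_of_mem_openStar hm fun i => by
      rw [hmid, abs_lt]
      have := abs_le.mp (he i)
      constructor <;> linarith
    have key := (starCocycle T hT).holonomy_mk_of_section
      (pathInto (Path.segment (toReal x) (toReal v)) hsplit.1 hy hv) (fun u => T x u)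
      fun t i j hi hj => by
        have ht := segment_mem_of_convex (convex_cube c₀) (toReal_mem_cube hx₀)
          (toReal_mem_cube hv₀) t
        exact hT c₀ hc₀ x hx₀ i (mem_corners_of_mem_openStar ht hi) j
          (mem_corners_of_mem_openStar ht hj)
    have hxx : T x x = 1 := mul_eq_left.mp (hT c₀ hc₀ x hx₀ x hx₀ x hx₀)
    change _ * T x (floorPt (toReal x)) = T x (floorPt (toReal v)) at key
    rw [floorPt_toReal, floorPt_toReal, hxx, mul_one] at key
    rw [key]
    exact hTc c₀ hc₀ x hx₀ v hv₀ e

/-- The holonomy of a cocycle over an unflawed region: a multiplicative functional on homotopy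
classes of paths, with the values of the local rule on trails. -/
theorem exists_holonomy {A : Type*} [TopologicalSpace A] {𝔄 : Subshift A (Lat D)}
    {a : Lat D → A} {C : Lat D → 𝔄.carrier → G} (hC : C ∈ cocycles 𝔄 G) {s R : ℕ}
    {c : Lat D → (box D s → A) → G} (hc : IsLocalRule 𝔄 C s c) (hs : s < R)
    (hS : S ⊆ unflawed 𝔄 a R) :
    ∃ Φ : FlatCocycle (Lat D) (realization S) G,
      ∀ {y z : Lat D} (ζ : Trail y z) (h : ∀ t, ζ.path t ∈ realization S)
        (hy : toReal y ∈ realization S) (hz : toReal z ∈ realization S),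
        Φ.holonomy (.mk (ζ.pathIn h hy hz)) = Trail.value c a ζ := by
  have hex : ∀ u ∈ S, ∃ b : 𝔄.carrier, block R b.1 u = block R a u :=
    fun u hu => exists_block_eq (Nat.zero_lt_of_lt hs) (hS hu)
  classical
  -- Transport from `u` is computed in an element of `𝔄` that agrees with `a` around `u`; the
  -- default `1` off `S` plays no role.
  let T : Lat D → Lat D → G := fun u v =>
    if h : u ∈ S then C (v - u) (shiftOn 𝔄 u (hex u h).choose) else 1
  have hTval : ∀ z, corners z ⊆ S → ∀ u ∈ corners z, ∀ v ∈ corners z, ∀ ζ : Trail u v,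
      ζ.InSet (corners z) → T u v = Trail.value c a ζ := by
    intro z hz u hu v hv ζ hζ
    have h1 : T u v = C (v - u) (shiftOn 𝔄 u (hex u (hz hu)).choose) := dif_pos (hz hu)
    rw [h1, ← value_eq_cocycle hC hc _ ζ]
    -- Corners of a cube are at distance at most `1`, so `1 + s ≤ R` suffices; this is the condition
    -- `s < R`.
    exact ζ.value_congr c fun w hw => block_eq_of_sub_mem (hex u (hz hu)).choose_spec
      (sub_mem_box_of_corners hu (hζ w hw)) (by omega)
  have hT : ∀ z, corners z ⊆ S → ∀ u ∈ corners z, ∀ v ∈ corners z, ∀ w ∈ corners z,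
      T v w * T u v = T u w := by
    intro z hz u hu v hv w hw
    obtain ⟨ζ, hζ⟩ := exists_trail_corners hu hv
    obtain ⟨ξ, hξ⟩ := exists_trail_corners hv hw
    rw [hTval z hz u hu v hv ζ hζ, hTval z hz v hv w hw ξ hξ,
      hTval z hz u hu w hw _ (hζ.append hξ), Trail.value_append]
  have hTc : ∀ z, corners z ⊆ S → ∀ v ∈ corners z, ∀ w ∈ corners z, w - v ∈ unitSteps D →
      T v w = c (w - v) (block s a v) := by
    intro z hz v hv w hw e
    have hadj : (latGraph D).Adj v w := e
    rw [hTval z hz v hv w hw (.cons hadj .nil)]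
    · simp [Trail.value]
    · exact (Trail.inSet_cons_iff hadj _).mpr ⟨hv, fun x hx => by
        rw [SimpleGraph.Walk.support_nil, List.mem_singleton] at hx
        exact hx ▸ hw⟩
  exact ⟨starCocycle T hT, starCocycle_holonomy_pathIn T hT hTc⟩

end Holonomy

/-! ### Conjugation of homotopy classes by paths -/

section PathAlgebra

open Path.Homotopic

variable {X : Type*} [TopologicalSpace X] {p q : X}

theorem trans_symm_trans_conj (γ : Path.Homotopic.Quotient p q) (x : Path.Homotopic.Quotient p p) :
    (γ.trans ((γ.symm.trans x).trans γ)).trans γ.symm = x := by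
  simp only [Quotient.trans_assoc]
  rw [Quotient.trans_symm, Quotient.trans_refl, ← Quotient.trans_assoc, Quotient.trans_symm,
    Quotient.refl_trans]

theorem trans_refl_conj (γ : Path.Homotopic.Quotient p q) :
    (γ.trans (.mk (Path.refl q))).trans γ.symm = .refl p := by
  rw [Quotient.mk_refl, Quotient.trans_refl, Quotient.trans_symm]

theorem map_conj {Z : Type*} [TopologicalSpace Z] (f : C(X, Z)) (γ : Path p q) (x : Path q q) :
    (((Path.Homotopic.Quotient.mk γ).trans (.mk x)).trans (.symm (.mk γ))).map f =
      (((Path.Homotopic.Quotient.mk γ).map f).trans (.mk (x.map f.continuous))).trans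
        ((Path.Homotopic.Quotient.mk γ).map f).symm := by
  rw [← Path.Homotopic.Quotient.mk_trans, ← Path.Homotopic.Quotient.mk_symm,
    ← Path.Homotopic.Quotient.mk_trans, ← Path.Homotopic.Quotient.mk_map,
    Path.map_trans, Path.map_trans]
  rfl

theorem FlatCocycle.holonomy_conj {ι G : Type*} [Group G] [TopologicalSpace G]
    [DiscreteTopology G] (Φ : FlatCocycle ι X G) (γ : Path.Homotopic.Quotient p q)
    (x : Path.Homotopic.Quotient q q) :
    Φ.holonomy ((γ.trans x).trans γ.symm) =
      (Φ.holonomy γ)⁻¹ * (Φ.holonomy x * Φ.holonomy γ) := by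
  rw [Φ.holonomy_trans, Φ.holonomy_trans, Φ.holonomy_symm]

end PathAlgebra

/-! ### Representing trails and change of basing -/

namespace ProperBaseRay

variable {D : ℕ} {A : Type*} [TopologicalSpace A] {𝔄 : Subshift A (Lat D)} {a : Lat D → A}
  {Y : Set (Lat D)} {ω : ProperBaseRay 𝔄 a Y} {r₀ : ℕ}

variable (ω) in
/-- There are basings of every range with arbitrarily late base points. -/
theorem exists_basing {R : ℕ} (hR : r₀ < R) (t₀ : ℝ≥0) :
    ∃ β : ω.Basing r₀, β.idx.r = R ∧ t₀ ≤ β.idx.t := by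
  obtain ⟨t₁, ht₁⟩ := Filter.eventually_atTop.mp (ω.eventually_mem R)
  let i : ω.Index r₀ := ⟨R, max t₀ t₁, hR, fun u hu => ht₁ u ((le_max_right _ _).trans hu)⟩
  have h := mem_openStar_floorPt i.base.1
  exact ⟨⟨i, floorPt i.base.1, toReal_mem_realization h, toCentre h⟩, rfl, le_max_left _ _⟩

theorem represents_iff (β : ω.Basing r₀) (ζ : Trail β.y β.y) (x : ω.properPi1 r₀) :
    Represents β ζ x ↔ ζ.InSet (Y ∩ unflawed 𝔄 a β.idx.r) ∧
      ∃ h : ∀ t, ζ.path t ∈ region 𝔄 a Y β.idx.r,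
        ((Path.Homotopic.Quotient.mk β.γ).trans (.mk (ζ.pathIn h β.mem β.mem))).trans
          (.symm (.mk β.γ)) = x.1 β.idx := by
  refine and_congr_right fun _ => ⟨?_, ?_⟩
  · rintro ⟨p, hp, e⟩
    have h : ∀ t, ζ.path t ∈ region 𝔄 a Y β.idx.r := fun t => hp t ▸ (p t).2
    refine ⟨h, ?_⟩
    have : ζ.pathIn h β.mem β.mem = p := Path.ext (funext fun t => Subtype.ext (hp t).symm)
    rw [this]
    exact e
  · rintro ⟨h, e⟩
    exact ⟨ζ.pathIn h β.mem β.mem, fun _ => rfl, e⟩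

/-- Cellular approximation applied to the component of `x`, transported along `γ` to the lattice
point of the basing. -/
theorem exists_represents (β : ω.Basing r₀) (x : ω.properPi1 r₀) :
    ∃ ζ : Trail β.y β.y, Represents β ζ x := by
  obtain ⟨ζ, hζ, h, e⟩ := exists_trail_of_path β.mem β.mem
    (((Path.Homotopic.Quotient.symm (.mk β.γ)).trans (x.1 β.idx)).trans (.mk β.γ))
  refine ⟨ζ, (represents_iff β ζ x).mpr ⟨hζ, h, ?_⟩⟩
  refine (congrArg (fun γ => ((Path.Homotopic.Quotient.mk β.γ).trans γ).trans
    (.symm (.mk β.γ))) e.symm).trans ?_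
  exact trans_symm_trans_conj _ _

theorem represents_nil_one (β : ω.Basing r₀) : Represents β .nil (1 : ω.properPi1 r₀) := by
  refine (represents_iff β _ _).mpr ⟨fun v hv => ?_, fun _ => β.mem, ?_⟩
  · rw [SimpleGraph.Walk.support_nil, List.mem_singleton] at hv
    exact hv ▸ mem_of_toReal_mem_realization β.mem
  · have : Trail.pathIn (.nil : Trail β.y β.y) (fun _ => β.mem) β.mem β.mem = Path.refl _ := rfl
    exact (congrArg (fun γ => ((Path.Homotopic.Quotient.mk β.γ).trans (.mk γ)).trans
      (.symm (.mk β.γ))) this).trans (trans_refl_conj _)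

theorem Index.bond_apply (i j : ω.Index r₀) (hr : i.r ≤ j.r) (ht : i.t ≤ j.t)
    (x : Path.Homotopic.Quotient j.base j.base) :
    i.bond j hr ht x = (Path.Homotopic.Quotient.symm (.mk (i.seg j.t ht).symm)).trans
      ((x.map ⟨Set.inclusion (region_anti 𝔄 a Y hr),
        continuous_inclusion (region_anti 𝔄 a Y hr)⟩).trans (.mk (i.seg j.t ht).symm)) :=
  rfl

variable {G : Type*} [Group G] [TopologicalSpace G] [DiscreteTopology G]

/-- The values along trails that represent the same element with respect to two basings are
conjugate. -/
theorem exists_value_eq_conj {C : Lat D → 𝔄.carrier → G} (hC : C ∈ cocycles 𝔄 G) {s : ℕ}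
    {c : Lat D → (box D s → A) → G} (hc : IsLocalRule 𝔄 C s c) (β β' : ω.Basing r₀)
    (hs : s < β.idx.r) (hr : β.idx.r ≤ β'.idx.r) (ht : β.idx.t ≤ β'.idx.t) :
    ∃ g : G, ∀ (x : ω.properPi1 r₀) (ζ : Trail β.y β.y) (ζ' : Trail β'.y β'.y),
      Represents β ζ x → Represents β' ζ' x →
        Trail.value c a ζ = g * Trail.value c a ζ' * g⁻¹ := by
  -- A single bundle, over the region of the smaller range, evaluates both trails; classes of the
  -- larger range enter it by inclusion.
  obtain ⟨Φ, hΦ⟩ := exists_holonomy (S := Y ∩ unflawed 𝔄 a β.idx.r) hC hc hs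
    Set.inter_subset_right
  let incl : C(region 𝔄 a Y β'.idx.r, region 𝔄 a Y β.idx.r) :=
    ⟨Set.inclusion (region_anti 𝔄 a Y hr), continuous_inclusion (region_anti 𝔄 a Y hr)⟩
  let γ : G := Φ.holonomy (.mk β.γ)
  let γ' : G := Φ.holonomy ((Path.Homotopic.Quotient.mk β'.γ).map incl)
  let τ : G := Φ.holonomy (.mk (β.idx.seg β'.idx.t ht).symm)
  -- Transport from the lattice point of `β'` back to the ray, back along the ray, then to the
  -- lattice point of `β`; this does not involve `x`.
  refine ⟨γ * τ * γ'⁻¹, fun x ζ ζ' hζ hζ' => ?_⟩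
  obtain ⟨-, h, e⟩ := (represents_iff β ζ x).mp hζ
  obtain ⟨-, h', e'⟩ := (represents_iff β' ζ' x).mp hζ'
  have hx := x.2 β.idx β'.idx hr ht
  have h1 : Φ.holonomy (x.1 β.idx) = γ⁻¹ * (Trail.value c a ζ * γ) := by
    rw [← e]
    exact (Φ.holonomy_conj _ _).trans
      (congrArg (fun v => γ⁻¹ * (v * γ)) (hΦ ζ h β.mem β.mem))
  have h2 : Φ.holonomy (Path.Homotopic.Quotient.map (x.1 β'.idx) incl) =
      γ'⁻¹ * (Trail.value c a ζ' * γ') := by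
    have e1 : Path.Homotopic.Quotient.map (x.1 β'.idx) incl =
        (((Path.Homotopic.Quotient.mk β'.γ).map incl).trans (.mk (ζ'.pathIn
          (fun t => region_anti 𝔄 a Y hr (h' t)) (region_anti 𝔄 a Y hr β'.mem)
          (region_anti 𝔄 a Y hr β'.mem)))).trans
          (((Path.Homotopic.Quotient.mk β'.γ).map incl).symm) := by
      rw [← e']
      exact map_conj incl _ _
    rw [e1]
    exact (Φ.holonomy_conj _ _).trans (congrArg (fun v => γ'⁻¹ * (v * γ')) (hΦ ζ' _ _ _))
  have h3 : Φ.holonomy (x.1 β.idx) =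
      τ * Φ.holonomy (Path.Homotopic.Quotient.map (x.1 β'.idx) incl) * τ⁻¹ := by
    rw [← hx]
    refine (congrArg Φ.holonomy (Index.bond_apply β.idx β'.idx hr ht (x.1 β'.idx))).trans ?_
    refine (Φ.holonomy_trans _ _).trans ?_
    exact congrArg₂ (· * ·) (Φ.holonomy_trans _ _) (Φ.holonomy_symm _)
  rw [h1, h2] at h3
  have h4 : Trail.value c a ζ = γ * (γ⁻¹ * (Trail.value c a ζ * γ)) * γ⁻¹ := by group
  rw [h4, h3]
  group

end ProperBaseRay

open ProperBaseRay

/-! ### Residue functions -/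

section Residue

variable {D : ℕ} {A : Type*} [TopologicalSpace A] {𝔄 : Subshift A (Lat D)} {a : Lat D → A}
  {Y : Set (Lat D)} {ω : ProperBaseRay 𝔄 a Y} {r₀ : ℕ}

/-- A residue function is computed by some local rule and basing of large range. -/
theorem IsResidue.exists_conj {G : Type*} [Group G] [TopologicalSpace G]
    [DiscreteTopology G] {κ : H1 𝔄 G} {ρ : ω.properPi1 r₀ → G} (h : IsResidue ω κ ρ)
    (C : cocycles 𝔄 G) (hC : (Quotient.mk (cohomSetoid 𝔄 G) C : H1 𝔄 G) = κ) {s : ℕ}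
    {c : Lat D → (box D s → A) → G} (hc : IsLocalRule 𝔄 C.1 s c) (β : ω.Basing r₀)
    (hs : s < β.idx.r) :
    ∃ g : G, ∀ (x : ω.properPi1 r₀) (ζ : Trail β.y β.y), Represents β ζ x →
      ρ x = g * Trail.value c a ζ * g⁻¹ := by
  obtain ⟨g, hg⟩ := h C hC s c hc β hs
  refine ⟨g⁻¹, fun x ζ hζ => ?_⟩
  rw [hg x ζ hζ]
  group

theorem IsResidue.value_eq {G : Type*} [CommGroup G] [TopologicalSpace G]
    [DiscreteTopology G] {κ : H1 𝔄 G} {ρ : ω.properPi1 r₀ → G} (h : IsResidue ω κ ρ)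
    (C : cocycles 𝔄 G) (hC : (Quotient.mk (cohomSetoid 𝔄 G) C : H1 𝔄 G) = κ) {s : ℕ}
    {c : Lat D → (box D s → A) → G} (hc : IsLocalRule 𝔄 C.1 s c) (β : ω.Basing r₀)
    (hs : s < β.idx.r) {x : ω.properPi1 r₀} {ζ : Trail β.y β.y} (hζ : Represents β ζ x) :
    Trail.value c a ζ = ρ x := by
  obtain ⟨g, hg⟩ := h C hC s c hc β hs
  rw [hg x ζ hζ, mul_comm g, mul_inv_cancel_right]

/-- The cocycle of a homomorphism `ℤ^D → G` has trivial residue. -/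
theorem IsResidue.eq_one_of_mem_trivialCocycles {G : Type*} [CommGroup G]
    [TopologicalSpace G] [DiscreteTopology G] {C : cocycleGroup 𝔄 G}
    (hC : C ∈ trivialCocycles 𝔄 G) {ρ : ω.properPi1 r₀ → G}
    (h : IsResidue ω (Quotient.mk (cohomSetoid 𝔄 G) ⟨C.1, C.2⟩) ρ)
    (x : ω.properPi1 r₀) : ρ x = 1 := by
  obtain ⟨f, hf⟩ := hC
  have hmem : (fun (z : Lat D) (_ : 𝔄.carrier) => f (Multiplicative.ofAdd z)) ∈ cocycles 𝔄 G :=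
    ⟨(continuous_of_discreteTopology (f := fun z : Lat D => f (Multiplicative.ofAdd z))).comp
      continuous_fst, fun y z _ => f.map_mul (.ofAdd y) (.ofAdd z)⟩
  have hc : IsLocalRule 𝔄 (fun (z : Lat D) (_ : 𝔄.carrier) => f (Multiplicative.ofAdd z)) 0
      (fun z _ => f (Multiplicative.ofAdd z)) := fun _ _ _ => rfl
  obtain ⟨β, hβ, -⟩ := exists_basing ω (show r₀ < r₀ + 1 by omega) 0
  obtain ⟨ζ, hζ⟩ := exists_represents β x
  rw [← h.value_eq ⟨_, hmem⟩ (Quotient.sound hf) hc β (by omega) hζ]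
  -- The radius-zero rule ignores the configuration, so its values telescope to the total
  -- displacement, which vanishes on a closed trail.
  have : ∀ {y z : Lat D} (ζ : Trail y z), Trail.value (s := 0)
      (fun (z : Lat D) (_ : box D 0 → A) => f (Multiplicative.ofAdd z)) a ζ =
        f (Multiplicative.ofAdd (z - y)) := by
    intro y z ζ
    induction ζ with
    | nil => simp [Trail.value]
    | cons e p ih =>
      rw [Trail.value, ih, ← _root_.map_mul, ← ofAdd_add, sub_add_sub_cancel]
  rw [this, sub_self, ofAdd_zero, _root_.map_one]

variable [Finite A] [DiscreteTopology A]

/-! ### Existence, uniqueness and vanishing for arbitrary discrete groups -/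

section Group

variable {G : Type*} [Group G] [TopologicalSpace G] [DiscreteTopology G]

variable (ω r₀) in
-- The residue is read off one cocycle, rule, basing and choice of trails. Any other data are
-- compared with these at a third basing, later than both on the ray and of range large enough for
-- the transfer function.
theorem exists_isResidue (κ : H1 𝔄 G) : ∃ ρ : ω.properPi1 r₀ → G, IsResidue ω κ ρ := by
  obtain ⟨C₀, rfl⟩ := Quotient.exists_rep κ
  obtain ⟨s₀, c₀, hc₀⟩ := exists_isLocalRule C₀.2
  obtain ⟨β₀, hβ₀, -⟩ := exists_basing ω (show r₀ < r₀ + s₀ + 1 by omega) 0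
  choose ζ₀ hζ₀ using exists_represents β₀
  refine ⟨fun x => Trail.value c₀ a (ζ₀ x), fun C hC s c hc β hs => ?_⟩
  obtain ⟨N, hN⟩ := exists_value_eq_of_cohomologous a (Quotient.exact hC.symm) hc₀ hc
  obtain ⟨β', hr', ht'⟩ := exists_basing (r₀ := r₀) ω
    (show r₀ < r₀ + N + β.idx.r + β₀.idx.r + 1 by omega) (max β.idx.t β₀.idx.t)
  obtain ⟨f, hf⟩ := hN β'.idx.r (by omega)
  obtain ⟨g₁, hg₁⟩ := exists_value_eq_conj C.2 hc β β' hs (by omega) ((le_max_left _ _).trans ht')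
  obtain ⟨g₂, hg₂⟩ := exists_value_eq_conj C₀.2 hc₀ β₀ β' (by omega) (by omega)
    ((le_max_right _ _).trans ht')
  refine ⟨g₁ * f β'.y * g₂⁻¹, fun x ζ hζ => ?_⟩
  obtain ⟨ζ', hζ'⟩ := exists_represents β' x
  change _ = _ * Trail.value c₀ a (ζ₀ x) * _
  rw [hg₁ x ζ ζ' hζ hζ', hg₂ x _ ζ' (hζ₀ x) hζ', hf _ _ ζ' fun v hv => (hζ'.1 v hv).2]
  group

theorem IsResidue.unique {κ : H1 𝔄 G} {ρ ρ' : ω.properPi1 r₀ → G} (h : IsResidue ω κ ρ)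
    (h' : IsResidue ω κ ρ') : ∃ g : G, ∀ x, ρ' x = g * ρ x * g⁻¹ := by
  obtain ⟨C, hC⟩ := Quotient.exists_rep κ
  obtain ⟨s, c, hc⟩ := exists_isLocalRule C.2
  obtain ⟨β, hβ, -⟩ := exists_basing ω (show r₀ < r₀ + s + 1 by omega) 0
  obtain ⟨g, hg⟩ := h C hC s c hc β (by omega)
  obtain ⟨g', hg'⟩ := h'.exists_conj C hC hc β (by omega)
  refine ⟨g' * g, fun x => ?_⟩
  obtain ⟨ζ, hζ⟩ := exists_represents β x
  rw [hg' x ζ hζ, hg x ζ hζ]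
  group

theorem IsResidue.map_one {κ : H1 𝔄 G} {ρ : ω.properPi1 r₀ → G} (h : IsResidue ω κ ρ) :
    ρ 1 = 1 := by
  obtain ⟨C, hC⟩ := Quotient.exists_rep κ
  obtain ⟨s, c, hc⟩ := exists_isLocalRule C.2
  obtain ⟨β, hβ, -⟩ := exists_basing ω (show r₀ < r₀ + s + 1 by omega) 0
  obtain ⟨g, hg⟩ := h.exists_conj C hC hc β (by omega)
  rw [hg 1 _ (represents_nil_one β)]
  simp [Trail.value]

/-- Residues of removable defects are trivial. -/
theorem IsResidue.eq_one_of_isRemovable {κ : H1 𝔄 G} {ρ : ω.properPi1 r₀ → G}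
    (h : IsResidue ω κ ρ) (ha : IsRemovable 𝔄 a) (x : ω.properPi1 r₀) : ρ x = 1 := by
  obtain ⟨r, hr, a', ha', heq⟩ := ha
  obtain ⟨C, hC⟩ := Quotient.exists_rep κ
  obtain ⟨s, c, hc⟩ := exists_isLocalRule C.2
  -- At range `s + r` the whole `s`-box around each vertex lies in the unflawed region of range `r`,
  -- where `a` and `a'` agree.
  obtain ⟨β, hβ, -⟩ := exists_basing ω (show r₀ < r₀ + (s + r) by omega) 0
  obtain ⟨g, hg⟩ := h.exists_conj C hC hc β (by omega)
  obtain ⟨ζ, hζ⟩ := exists_represents β x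
  have h1 : Trail.value c a ζ = Trail.value c a' ζ := ζ.value_congr c fun v hv =>
    block_eq_iff.mpr fun u hu => (heq _ (add_mem_unflawed (by omega)
      (unflawed_anti 𝔄 a (by omega : s + r ≤ β.idx.r) (hζ.1 v hv).2) hu)).symm
  rw [hg x ζ hζ, h1, value_closed_eq_one C.2 hc ⟨a', ha'⟩ ζ]
  simp

end Group

/-! ### Abelian coefficients: the residue homomorphisms -/

section CommGroup

variable {G : Type*} [CommGroup G] [TopologicalSpace G] [DiscreteTopology G]

theorem IsResidue.eq {κ : H1 𝔄 G} {ρ ρ' : ω.properPi1 r₀ → G} (h : IsResidue ω κ ρ)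
    (h' : IsResidue ω κ ρ') (x : ω.properPi1 r₀) : ρ' x = ρ x := by
  obtain ⟨g, hg⟩ := h.unique h'
  rw [hg, mul_comm g, mul_inv_cancel_right]

theorem IsResidue.map_mul {κ : H1 𝔄 G} {ρ : ω.properPi1 r₀ → G} (h : IsResidue ω κ ρ)
    (x y : ω.properPi1 r₀) : ρ (x * y) = ρ x * ρ y := by
  obtain ⟨C, hC⟩ := Quotient.exists_rep κ
  obtain ⟨s, c, hc⟩ := exists_isLocalRule C.2
  obtain ⟨β, hβ, -⟩ := exists_basing ω (show r₀ < r₀ + s + 1 by omega) 0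
  obtain ⟨Φ, hΦ⟩ := exists_holonomy (S := Y ∩ unflawed 𝔄 a β.idx.r) C.2 hc
    (by omega : s < β.idx.r) Set.inter_subset_right
  -- With `G` abelian the conjugation by `γ` drops out, and the residue is the holonomy of one
  -- component of `x`.
  have key : ∀ x : ω.properPi1 r₀, ρ x = Φ.holonomy (x.1 β.idx) := fun x => by
    obtain ⟨ζ, hζ⟩ := exists_represents β x
    obtain ⟨-, h', e⟩ := (represents_iff β ζ x).mp hζ
    rw [← h.value_eq C hC hc β (by omega) hζ, ← e]
    refine Eq.trans ?_ (Φ.holonomy_conj _ _).symm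
    rw [mul_comm, mul_inv_cancel_right]
    exact (hΦ ζ h' β.mem β.mem).symm
  rw [key, key, key]
  exact Φ.holonomy_trans _ _

/-- At a common radius, the product of local rules is a local rule for the product cocycle, and all
three are evaluated on the same trail. -/
theorem IsResidue.mul {C C' : cocycleGroup 𝔄 G} {ρ ρ' ρ'' : ω.properPi1 r₀ → G}
    (h : IsResidue ω (Quotient.mk (cohomSetoid 𝔄 G) ⟨C.1, C.2⟩) ρ)
    (h' : IsResidue ω (Quotient.mk (cohomSetoid 𝔄 G) ⟨C'.1, C'.2⟩) ρ')
    (h'' : IsResidue ω (Quotient.mk (cohomSetoid 𝔄 G) ⟨(C * C').1, (C * C').2⟩) ρ'')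
    (x : ω.properPi1 r₀) : ρ'' x = ρ x * ρ' x := by
  obtain ⟨s, c, hc⟩ := exists_isLocalRule C.2
  obtain ⟨s', c', hc'⟩ := exists_isLocalRule C'.2
  have hd := isLocalRule_enlarge (le_max_left s s') hc
  have hd' := isLocalRule_enlarge (le_max_right s s') hc'
  have hd'' : IsLocalRule 𝔄 (C * C').1 (max s s') fun e w =>
      enlarge (le_max_left s s') c e w * enlarge (le_max_right s s') c' e w :=
    fun e he b => congrArg₂ (· * ·) (hd e he b) (hd' e he b)
  obtain ⟨β, hβ, -⟩ := exists_basing ω (show r₀ < r₀ + max s s' + 1 by omega) 0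
  have hs : max s s' < β.idx.r := by omega
  obtain ⟨ζ, hζ⟩ := exists_represents β x
  rw [← h.value_eq _ rfl hd β hs hζ, ← h'.value_eq _ rfl hd' β hs hζ,
    ← h''.value_eq _ rfl hd'' β hs hζ, value_mul]

variable (ω r₀) in
/-- The residue homomorphism on cocycles. -/
theorem exists_residueHom : ∃ res : cocycleGroup 𝔄 G →* ω.properPi1 r₀ →* G,
    ∀ C : cocycleGroup 𝔄 G,
      IsResidue ω (Quotient.mk (cohomSetoid 𝔄 G) ⟨C.1, C.2⟩) (fun x => res C x) := by
  choose ρ hρ using fun C : cocycleGroup 𝔄 G =>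
    exists_isResidue ω r₀ (Quotient.mk (cohomSetoid 𝔄 G) ⟨C.1, C.2⟩)
  exact ⟨MonoidHom.mk' (fun C => MonoidHom.mk' (ρ C) (hρ C).map_mul) fun C C' =>
    MonoidHom.ext fun x => (hρ C).mul (hρ C') (hρ (C * C')) x, hρ⟩

variable (ω r₀) in
-- The homomorphism descends because trivial cocycles have trivial residue; it is unique because
-- abelian residue functions are.
theorem existsUnique_residueHom : ∃! res : H1Group 𝔄 G →* ω.properPi1 r₀ →* G,
    ∀ C : cocycleGroup 𝔄 G,
      IsResidue ω (Quotient.mk (cohomSetoid 𝔄 G) ⟨C.1, C.2⟩)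
        (fun x => res (QuotientGroup.mk C) x) := by
  obtain ⟨res, hres⟩ := exists_residueHom ω r₀ (G := G)
  refine ⟨QuotientGroup.lift _ res fun C hC => MonoidHom.ext fun x =>
    (hres C).eq_one_of_mem_trivialCocycles hC x, hres, fun res' hres' => ?_⟩
  refine MonoidHom.ext fun κ => ?_
  obtain ⟨C, rfl⟩ := QuotientGroup.mk_surjective κ
  exact MonoidHom.ext fun x => (hres C).eq (hres' C) x

end CommGroup

end Residue

end CrystalDefect

/-! ### Assembly of the theorem -/

theorem theorem2p6 {D : ℕ} (hD : 1 ≤ D) {A : Type*} [Finite A] [TopologicalSpace A]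
    [DiscreteTopology A] (𝔄 : Subshift A (CrystalDefect.Lat D)) (a : CrystalDefect.Lat D → A)
    (ha : a ∈ CrystalDefect.slightlyDefective 𝔄)
    (r₀ : ℕ) (Y : Set (CrystalDefect.Lat D))
    (hY : CrystalDefect.IsProjectiveComponent 𝔄 a r₀ Y)
    (hYuniq : ∀ Y', CrystalDefect.IsProjectiveComponent 𝔄 a r₀ Y' → Y' = Y)
    (hcodim : CrystalDefect.HasProjectiveCodimTwo 𝔄 a r₀ Y)
    (ω : CrystalDefect.ProperBaseRay 𝔄 a Y) :
    -- representing trails exist at all ranges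
    (∀ R, r₀ < R → ∃ β : ω.Basing r₀, β.idx.r = R) ∧
    (∀ (β : ω.Basing r₀) (x : ω.properPi1 r₀),
      ∃ ζ : CrystalDefect.Trail β.y β.y, CrystalDefect.ProperBaseRay.Represents β ζ x) ∧
    -- arbitrary discrete coefficient groups
    (∀ (G : Type*) [Group G] [TopologicalSpace G] [DiscreteTopology G],
      -- every cocycle is locally determined
      (∀ C ∈ CrystalDefect.cocycles 𝔄 G, ∃ s c, CrystalDefect.IsLocalRule 𝔄 C s c) ∧
      -- the residue is well defined on cohomology classes, up to conjugation
      (∀ κ : CrystalDefect.H1 𝔄 G, ∃ ρ : ω.properPi1 r₀ → G,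
        CrystalDefect.IsResidue ω κ ρ ∧
        ∀ ρ' : ω.properPi1 r₀ → G, CrystalDefect.IsResidue ω κ ρ' →
          ∃ g : G, ∀ x, ρ' x = g * ρ x * g⁻¹) ∧
      -- a nontrivial residue forces an essential codimension-two defect
      (∀ (κ : CrystalDefect.H1 𝔄 G) (ρ : ω.properPi1 r₀ → G), CrystalDefect.IsResidue ω κ ρ →
        (∃ x, ρ x ≠ 1) →
        CrystalDefect.IsEssential 𝔄 a ∧ Nontrivial (ω.properPi1 r₀))) ∧
    -- abelian coefficients: the residue is a homomorphism in each variable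
    (∀ (G : Type*) [CommGroup G] [TopologicalSpace G] [DiscreteTopology G],
      ∃! res : CrystalDefect.H1Group 𝔄 G →* ω.properPi1 r₀ →* G,
        ∀ C : CrystalDefect.cocycleGroup 𝔄 G,
          CrystalDefect.IsResidue ω
            (Quotient.mk (CrystalDefect.cohomSetoid 𝔄 G) ⟨C.1, C.2⟩)
            (fun x => res (QuotientGroup.mk C) x)) := by
  refine ⟨fun R hR => ?_, CrystalDefect.ProperBaseRay.exists_represents, fun G => ?_, fun G => ?_⟩
  · obtain ⟨β, hβ, -⟩ := CrystalDefect.ProperBaseRay.exists_basing ω hR 0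
    exact ⟨β, hβ⟩
  · intro _ _ _
    refine ⟨fun C hC => CrystalDefect.exists_isLocalRule hC, fun κ => ?_, ?_⟩
    · obtain ⟨ρ, hρ⟩ := CrystalDefect.exists_isResidue ω r₀ κ
      exact ⟨ρ, hρ, fun ρ' hρ' => hρ.unique hρ'⟩
    · rintro κ ρ hρ ⟨x, hx⟩
      exact ⟨fun hrem => hx (hρ.eq_one_of_isRemovable hrem x),
        ⟨x, 1, fun h => hx (h ▸ hρ.map_one)⟩⟩
  · intro _ _ _
    exact CrystalDefect.existsUnique_residueHom ω r₀
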